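/- All Hilbert spaces are complex, inner products are linear in the second variable, and $[S]$ denotes the norm-closed linear span of a set $S$. **$C^*$-bases and modules.** A $C^*$-base $\mathfrak b=(\mathfrak K,\mathfrak B,\mathfrak B^\dagger)$ consists of a Hilbert space $\mathfrak K$ and two commuting nondegenerate $C^*$-algebras $\mathfrak B,\mathfrak B^\dagger\subseteq\mathcal L(\mathfrak K)$; its opposite is $\mathfrak b^\dagger=(\mathfrak K,\mathfrak B^\dagger,\mathfrak B)$. A $C^*$-$\mathfrak b$-module $H_\alpha$ is a Hilbert space $H$ with a closed subspace $\alpha\subseteq\mathcal L(\mathfrak K,H)$ such that $[\alpha\mathfrak K]=H$, $[\alpha\mathfrak B]=\alpha$, $[\alpha^*\alpha]=\mathfrak B$; it carries the representation $\rho_\alpha\colon\mathfrak B^\dagger\to\mathcal L(H)$, $\rho_\alpha(c)\xi\zeta=\xi c\zeta$ $(\xi\in\alpha,\zeta\in\mathfrak K)$. A tuple $(H,\alpha_1,\dots,\alpha_n)$ is a $C^*$-$(\mathfrak b_1,\dots,\mathfrak b_n)$-module if each $H_{\alpha_i}$ is a $C^*$-$\mathfrak b_i$-module and $[\rho_{\alpha_i}(\mathfrak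 B_i^\dagger)\alpha_j]=\alpha_j$ for $i\ne j$. A morphism between such modules $(H,\alpha_i)_i$ and $(K,\gamma_i)_i$ is an operator $T\in\mathcal L(H,K)$ with $T\alpha_i\subseteq\gamma_i$ and $T^*\gamma_i\subseteq\alpha_i$ for all $i$. **Relative tensor product.** For a $C^*$-$\mathfrak b$-module $H_\beta$ and a $C^*$-$\mathfrak b^\dagger$-module $K_\gamma$, $H\,{}_\beta\!\otimes_\gamma K$ is the Hilbert space spanned by elements $\xi\otimes\zeta\otimes\eta$ $(\xi\in\beta,\zeta\in\mathfrak K,\eta\in\gamma)$ with $\langle\xi\otimes\zeta\otimes\eta|\xi'\otimes\zeta'\otimes\eta'\rangle=\langle\zeta|\xi^*\xi'\eta^*\eta'\zeta'\rangle$. Define operators $|\xi\rangle_1\colon K\to H\,{}_\beta\!\otimes_\gamma K$, $\eta\zeta\mapsto\xi\otimes\zeta\otimes\eta$, and $|\eta\rangle_2\colon H\to H\,{}_\beta\!\otimes_\gamma K$, $\xi\zeta\mapsto\xi\otimes\zeta\otimes\eta$; write $\langle\xi|_i=|\xi\rangle_i^*$, $|\beta\rangle_1=\{|\xi\rangle_1:\xi\in\beta\}$,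 and so on. For further module structures $\alpha$ on $H$ and $\delta$ on $K$ put $\alpha\triangleleft\gamma=[|\gamma\rangle_2\alpha]$ and $\beta\triangleright\delta=[|\beta\rangle_1\delta]$. $\Sigma$ denotes the flip $\xi\otimes\zeta\otimes\eta\mapsto\eta\otimes\zeta\otimes\xi$. Unitaries $S$ with $S\beta=\beta'$ and $T$ with $T\gamma=\gamma'$ induce $S\otimes 1$ and $1\otimes T$ by $\xi\otimes\zeta\otimes\eta\mapsto S\xi\otimes\zeta\otimes\eta$ and $\xi\otimes\zeta\otimes\eta\mapsto\xi\otimes\zeta\otimes T\eta$. Iterated relative tensor products are identified via the canonical associativity isomorphism $(H\,{}_\beta\!\otimes_\gamma K)\,{}_{\beta\triangleright\epsilon}\!\otimes_\phi L\cong H\,{}_\beta\!\otimes_{\gamma\triangleleft\phi}(K\,{}_\epsilon\!\otimes_\phi L)$, $|\eta\rangle_2|\xi\rangle_1k\mapsto|\xi\rangle_1|\eta\rangle_2k$ $(\xi\in\beta,k\in K,\eta\in\phi)$. **$C^*$-pseudo-multiplicative unitaries.** Such a unitary over $\mathfrak b$ consists of a $C^*$-$(\mathfrak b^\dagger,\mathfrak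 b,\mathfrak b^\dagger)$-module $(H,\widehat\beta,\alpha,\beta)$ and a unitary $V\colon H\,{}_{\widehat\beta}\!\otimes_\alpha H\to H\,{}_\alpha\!\otimes_\beta H$ with $$V(\alpha\triangleleft\alpha)=\alpha\triangleright\alpha,\quad V(\widehat\beta\triangleright\beta)=\widehat\beta\triangleleft\beta,\quad V(\widehat\beta\triangleright\widehat\beta)=\alpha\triangleright\widehat\beta,\quad V(\beta\triangleleft\alpha)=\beta\triangleleft\beta$$ and $V_{12}V_{13}V_{23}=V_{23}V_{12}$ on $H\,{}_{\widehat\beta}\!\otimes_\alpha H\,{}_{\widehat\beta}\!\otimes_\alpha H$ (leg notation: $V_{ij}$ acts like $V$ on the $i$th and $j$th factor). Its legs are $$A=A_V=[\langle\alpha|_1V|\widehat\beta\rangle_1]\subseteq\mathcal L(H),\qquad\widehat A=\widehat A_V=[\langle\beta|_2V|\alpha\rangle_2]\subseteq\mathcal L(H),$$ and $V$ is regular if $[\langle\alpha|_1V|\alpha\rangle_2]=[\alpha\alpha^*]$. **$C^*$-pseudo-Kac systems.** Let $\mathfrak b$ be a $C^*$-base and $(H,\widehat\alpha,\widehat\beta,\alpha,\beta)$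 a $C^*$-$(\mathfrak b,\mathfrak b^\dagger,\mathfrak b,\mathfrak b^\dagger)$-module. Let $U\in\mathcal L(H)$ be a symmetry, $U=U^*=U^{-1}$, that is a morphism from $(H,\widehat\alpha,\widehat\beta)$ to $(H,\alpha,\beta)$, and let $V\colon H\,{}_{\widehat\beta}\!\otimes_\alpha H\to H\,{}_\alpha\!\otimes_\beta H$ be a $C^*$-pseudo-multiplicative unitary over $\mathfrak b$. Put $$\check V=\Sigma(1\otimes U)V(1\otimes U)\Sigma\colon H\,{}_{\widehat\alpha}\!\otimes_{\widehat\beta}H\to H\,{}_{\widehat\beta}\!\otimes_{\alpha}H,\qquad\widehat V=\Sigma(U\otimes1)V(U\otimes1)\Sigma\colon H\,{}_{\alpha}\!\otimes_{\beta}H\to H\,{}_{\beta}\!\otimes_{\widehat\alpha}H.$$ $(V,U)$ is a $C^*$-pseudo-Kac system if $\check V$ and $\widehat V$ are $C^*$-pseudo-multiplicative unitaries over $\mathfrak b^\dagger$ (on $(H,\widehat\alpha,\widehat\beta,\alpha)$ and $(H,\alpha,\beta,\widehat\alpha)$, respectively), $V,\check V,\widehat V$ are regular, and $(\Sigma(1\otimes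 U)V)^3=\mathrm{id}$ on $H\,{}_{\widehat\beta}\!\otimes_\alpha H$. **Proposition.** Let $(V,U)$ be a $C^*$-pseudo-Kac system on $(H,\widehat\alpha,\widehat\beta,\alpha,\beta)$. Then $$[A\widehat A]=[\widehat\alpha\,\widehat\alpha^*]\subseteq\mathcal L(H).$$ -/

import Mathlib

open scoped InnerProduct InnerProductSpace ComplexConjugate

noncomputable section

namespace PseudoKac

/-! ### Closed linear spans -/

/-- The closed linear span `[S]`. -/
def cspan {E : Type*} [NormedAddCommGroup E] [NormedSpace ℂ E] (S : Set E) : Submodule ℂ E :=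
  (Submodule.span ℂ S).topologicalClosure

section Cspan

variable {E F : Type*} [NormedAddCommGroup E] [NormedSpace ℂ E]
  [NormedAddCommGroup F] [NormedSpace ℂ F]

theorem subset_cspan (S : Set E) : S ⊆ cspan S := fun _ hx =>
  Submodule.le_topologicalClosure _ (Submodule.subset_span hx)

theorem isClosed_cspan (S : Set E) : IsClosed (cspan S : Set E) :=
  Submodule.isClosed_topologicalClosure _

theorem cspan_le {S : Set E} {C : Submodule ℂ E} (hC : IsClosed (C : Set E)) (h : S ⊆ C) :
    cspan S ≤ C :=
  Submodule.topologicalClosure_minimal _ (Submodule.span_le.2 h) hC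

theorem cspan_map_mem (f : E →L[ℂ] F) {S : Set E} {C : Submodule ℂ F}
    (hC : IsClosed (C : Set F)) (h : ∀ a ∈ S, f a ∈ C) : ∀ a ∈ cspan S, f a ∈ C := by
  have h1 : IsClosed ((C.comap (f : E →ₗ[ℂ] F) : Submodule ℂ E) : Set E) :=
    hC.preimage f.continuous
  exact fun a ha => cspan_le (C := C.comap (f : E →ₗ[ℂ] F)) h1 (fun a ha => h a ha) ha

theorem cspan_eq_top_of_forall {S T : Set E} (hS : cspan S = ⊤) (h : ∀ a ∈ S, a ∈ cspan T) :
    cspan T = ⊤ :=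
  top_le_iff.1 (hS ▸ cspan_le (isClosed_cspan T) h)

theorem denseRange_linearCombination {ι : Type*} {x : ι → E} (hx : cspan (Set.range x) = ⊤) :
    DenseRange (Finsupp.linearCombination ℂ x) := by
  rw [DenseRange, ← LinearMap.coe_range, Finsupp.range_linearCombination]
  exact Submodule.dense_iff_topologicalClosure_eq_top.2 hx

theorem ext_of_cspan_eq_top {ι : Type*} {x : ι → E} (hx : cspan (Set.range x) = ⊤)
    {S T : E →L[ℂ] F} (h : ∀ i, S (x i) = T (x i)) : S = T := by
  apply ContinuousLinearMap.ext_on (s := Set.range x)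
  · exact Submodule.dense_iff_topologicalClosure_eq_top.2 hx
  · rintro _ ⟨i, rfl⟩
    exact h i

end Cspan

/-! ### Hilbert spaces and operators determined by Gram kernels -/

/-- Positivity of the quadratic form of a kernel. -/
def KerNonneg {ι : Type*} (k : ι → ι → ℂ) : Prop :=
  ∀ f : ι →₀ ℂ, 0 ≤ (f.sum fun i a => f.sum fun j b => conj a * b * k i j).re

/-- Positive semidefinite kernels. -/
structure IsPSD {ι : Type*} (k : ι → ι → ℂ) : Prop where
  conj_symm : ∀ i j, conj (k i j) = k j i
  nonneg : KerNonneg k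

section Gram

variable {ι : Type*} {k : ι → ι → ℂ}

/-- The sesquilinear form `⟨i | j⟩ = k i j` on the linear span of the symbols `i : ι`. -/
@[reducible]
def preGramCore (h : IsPSD k) : PreInnerProductSpace.Core ℂ (ι →₀ ℂ) where
  inner f g := f.sum fun i a => g.sum fun j b => conj a * b * k i j
  conj_inner_symm f g := by
    rw [Finsupp.sum_comm]
    simp only [map_finsuppSum, map_mul, Complex.conj_conj, h.conj_symm]
    simp only [mul_comm]
  re_inner_nonneg f := h.nonneg f
  add_left f g l := by
    rw [Finsupp.sum_add_index'] <;> simp [← Finsupp.sum_add, add_mul]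
  smul_left f g r := by
    rw [Finsupp.sum_smul_index] <;> simp [Finsupp.mul_sum, mul_assoc]

/-- The linear span of the symbols `i : ι`, as a space with the form determined by `k`. -/
@[nolint unusedArguments]
def PreGram (_h : IsPSD k) : Type _ := ι →₀ ℂ

instance PreGram.instAddCommGroup (h : IsPSD k) : AddCommGroup (PreGram h) :=
  inferInstanceAs (AddCommGroup (ι →₀ ℂ))

instance PreGram.instModule (h : IsPSD k) : Module ℂ (PreGram h) :=
  inferInstanceAs (Module ℂ (ι →₀ ℂ))

instance PreGram.instCore (h : IsPSD k) : PreInnerProductSpace.Core ℂ (PreGram h) :=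
  preGramCore h

instance PreGram.instSeminormedAddCommGroup (h : IsPSD k) : SeminormedAddCommGroup (PreGram h) :=
  InnerProductSpace.Core.toSeminormedAddCommGroup (𝕜 := ℂ)

instance PreGram.instInnerProductSpace (h : IsPSD k) : InnerProductSpace ℂ (PreGram h) :=
  .ofCore _

/-- The Hilbert space obtained from the form `k` by separated completion. -/
def GramSpace (h : IsPSD k) : Type _ := UniformSpace.Completion (PreGram h)

instance (h : IsPSD k) : NormedAddCommGroup (GramSpace h) :=
  inferInstanceAs (NormedAddCommGroup (UniformSpace.Completion (PreGram h)))
instance (h : IsPSD k) : InnerProductSpace ℂ (GramSpace h) :=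
  inferInstanceAs (InnerProductSpace ℂ (UniformSpace.Completion (PreGram h)))
instance (h : IsPSD k) : CompleteSpace (GramSpace h) :=
  inferInstanceAs (CompleteSpace (UniformSpace.Completion (PreGram h)))

/-- The generating vector with index `i`. -/
def GramSpace.gen (h : IsPSD k) (i : ι) : GramSpace h :=
  ((show PreGram h from Finsupp.single i (1 : ℂ)) : UniformSpace.Completion (PreGram h))

theorem GramSpace.inner_gen (h : IsPSD k) (i j : ι) :
    ⟪GramSpace.gen h i, GramSpace.gen h j⟫_ℂ = k i j := by
  refine (UniformSpace.Completion.inner_coe (𝕜 := ℂ) (E := PreGram h) _ _).trans ?_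
  change Finsupp.sum (Finsupp.single i (1 : ℂ)) (fun i a =>
    Finsupp.sum (Finsupp.single j (1 : ℂ)) fun j b => conj a * b * k i j) = _
  simp

theorem GramSpace.cspan_gen (h : IsPSD k) : cspan (Set.range (GramSpace.gen h)) = ⊤ := by
  let c : PreGram h →ₗ[ℂ] GramSpace h :=
    (UniformSpace.Completion.toComplL (𝕜 := ℂ) (E := PreGram h)).toLinearMap
  have key : ∀ f : ι →₀ ℂ, c f ∈ Submodule.span ℂ (Set.range (GramSpace.gen h)) := by
    intro f
    induction f using Finsupp.induction_linear with
    | zero => exact (map_zero c).symm ▸ Submodule.zero_mem _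
    | add f g hf hg => exact (map_add c (f : PreGram h) g).symm ▸ Submodule.add_mem _ hf hg
    | single i a =>
      have h1 : (Finsupp.single i a : ι →₀ ℂ) = a • Finsupp.single i 1 := by simp
      rw [h1]
      exact (map_smul c a (Finsupp.single i (1 : ℂ) : ι →₀ ℂ)).symm ▸
        Submodule.smul_mem _ _ (Submodule.subset_span ⟨i, rfl⟩)
  refine Submodule.dense_iff_topologicalClosure_eq_top.1 ?_
  refine Dense.mono ?_ (UniformSpace.Completion.denseRange_coe (α := PreGram h))
  rintro _ ⟨f, rfl⟩
  exact key f

variable {E F : Type*} [NormedAddCommGroup E] [InnerProductSpace ℂ E]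
  [NormedAddCommGroup F] [InnerProductSpace ℂ F]

theorem inner_linearCombination (x : ι → E) (f : ι →₀ ℂ) :
    ⟪Finsupp.linearCombination ℂ x f, Finsupp.linearCombination ℂ x f⟫_ℂ =
      f.sum fun i a => f.sum fun j b => conj a * b * ⟪x i, x j⟫_ℂ := by
  simp only [Finsupp.linearCombination_apply, Finsupp.sum_inner, Finsupp.inner_sum,
    inner_smul_left, inner_smul_right]
  simp only [Finsupp.sum, Finset.mul_sum]
  rw [Finset.sum_comm]
  refine Finset.sum_congr rfl fun i _ => Finset.sum_congr rfl fun j _ => ?_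
  ring

theorem norm_bound_of_kerNonneg (x : ι → E) (y : ι → F) {C : ℝ} (hC : 0 ≤ C)
    (h : KerNonneg fun i j => (C : ℂ) ^ 2 * ⟪x i, x j⟫_ℂ - ⟪y i, y j⟫_ℂ) (f : ι →₀ ℂ) :
    ‖Finsupp.linearCombination ℂ y f‖ ≤ C * ‖Finsupp.linearCombination ℂ x f‖ := by
  have h1 := h f
  have h2 : (f.sum fun i a => f.sum fun j b => conj a * b *
      ((C : ℂ) ^ 2 * ⟪x i, x j⟫_ℂ - ⟪y i, y j⟫_ℂ)) =
      ((C ^ 2 : ℝ) : ℂ) * ⟪Finsupp.linearCombination ℂ x f, Finsupp.linearCombination ℂ x f⟫_ℂ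
        - ⟪Finsupp.linearCombination ℂ y f, Finsupp.linearCombination ℂ y f⟫_ℂ := by
    rw [inner_linearCombination, inner_linearCombination]
    simp only [Finsupp.sum, Finset.mul_sum, ← Finset.sum_sub_distrib]
    refine Finset.sum_congr rfl fun i _ => Finset.sum_congr rfl fun j _ => ?_
    push_cast
    ring
  rw [h2, Complex.sub_re, Complex.re_ofReal_mul, sub_nonneg] at h1
  have h4 := inner_self_eq_norm_sq (𝕜 := ℂ) (Finsupp.linearCombination ℂ x f)
  have h5 := inner_self_eq_norm_sq (𝕜 := ℂ) (Finsupp.linearCombination ℂ y f)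
  simp only [RCLike.re_to_complex] at h4 h5
  rw [h4, h5, ← mul_pow] at h1
  exact (sq_le_sq₀ (norm_nonneg _) (by positivity)).1 h1

theorem norm_linearCombination_eq {x : ι → E} {y : ι → F}
    (h : ∀ i j, ⟪x i, x j⟫_ℂ = ⟪y i, y j⟫_ℂ) (f : ι →₀ ℂ) :
    ‖Finsupp.linearCombination ℂ y f‖ = ‖Finsupp.linearCombination ℂ x f‖ := by
  have h1 := inner_linearCombination x f
  have h2 := inner_linearCombination y f
  simp only [h] at h1
  rw [← h2] at h1
  have h4 := inner_self_eq_norm_sq (𝕜 := ℂ) (Finsupp.linearCombination ℂ x f)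
  have h5 := inner_self_eq_norm_sq (𝕜 := ℂ) (Finsupp.linearCombination ℂ y f)
  rw [h1, h5] at h4
  exact (sq_eq_sq₀ (norm_nonneg _) (norm_nonneg _)).1 h4

variable [CompleteSpace F]

/-- The bounded operator determined by `x i ↦ y i` (for a family `x` with dense span). -/
def gramMap (x : ι → E) (y : ι → F) : E →L[ℂ] F :=
  (Finsupp.linearCombination ℂ y).extendOfNorm (Finsupp.linearCombination ℂ x)

theorem gramMap_apply {x : ι → E} {y : ι → F} (hx : cspan (Set.range x) = ⊤)
    {C : ℝ} (hC : 0 ≤ C)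
    (h : KerNonneg fun i j => (C : ℂ) ^ 2 * ⟪x i, x j⟫_ℂ - ⟪y i, y j⟫_ℂ) (i : ι) :
    gramMap x y (x i) = y i := by
  have := LinearMap.extendOfNorm_eq (f := Finsupp.linearCombination ℂ y)
    (e := Finsupp.linearCombination ℂ x) (denseRange_linearCombination hx)
    ⟨C, norm_bound_of_kerNonneg x y hC h⟩ (Finsupp.single i 1)
  simpa [gramMap] using this

theorem norm_gramMap_le {x : ι → E} {y : ι → F} (hx : cspan (Set.range x) = ⊤)
    {C : ℝ} (hC : 0 ≤ C)
    (h : KerNonneg fun i j => (C : ℂ) ^ 2 * ⟪x i, x j⟫_ℂ - ⟪y i, y j⟫_ℂ) :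
    ‖gramMap x y‖ ≤ C :=
  LinearMap.opNorm_extendOfNorm_le (denseRange_linearCombination hx) hC
    (norm_bound_of_kerNonneg x y hC h)

variable [CompleteSpace E]

/-- The unitary determined by `x i ↦ y i`, for two families with dense spans and equal Gram
kernels. -/
def gramEquiv (x : ι → E) (y : ι → F) (hx : cspan (Set.range x) = ⊤)
    (hy : cspan (Set.range y) = ⊤) (h : ∀ i j, ⟪x i, x j⟫_ℂ = ⟪y i, y j⟫_ℂ) : E ≃ₗᵢ[ℂ] F :=
  LinearEquiv.extendOfIsometry (LinearEquiv.refl ℂ (ι →₀ ℂ)) (Finsupp.linearCombination ℂ x)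
    (Finsupp.linearCombination ℂ y) (denseRange_linearCombination hx)
    (denseRange_linearCombination hy) (norm_linearCombination_eq h)

theorem gramEquiv_apply {x : ι → E} {y : ι → F} (hx : cspan (Set.range x) = ⊤)
    (hy : cspan (Set.range y) = ⊤) (h : ∀ i j, ⟪x i, x j⟫_ℂ = ⟪y i, y j⟫_ℂ) (i : ι) :
    gramEquiv x y hx hy h (x i) = y i := by
  have := LinearEquiv.extendOfIsometry_eq (f := LinearEquiv.refl ℂ (ι →₀ ℂ))
    (e₁ := Finsupp.linearCombination ℂ x) (e₂ := Finsupp.linearCombination ℂ y)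
    (denseRange_linearCombination hx)
    (denseRange_linearCombination hy) (norm_linearCombination_eq h) (Finsupp.single i 1)
  simpa [gramEquiv] using this

end Gram

/-! ### Positivity of Schur products of commuting operator matrices -/

section Schur

variable {𝔎 X Y : Type*} [NormedAddCommGroup 𝔎] [InnerProductSpace ℂ 𝔎] [CompleteSpace 𝔎]
  [NormedAddCommGroup X] [InnerProductSpace ℂ X] [CompleteSpace X]
  [NormedAddCommGroup Y] [InnerProductSpace ℂ Y] [CompleteSpace Y]

theorem exists_sqrt {P : X →L[ℂ] X} (hP : 0 ≤ P) :
    ∃ R : X →L[ℂ] X, (R)† = R ∧ R * R = P ∧ ∀ T, Commute P T → Commute R T :=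
  ⟨CFC.sqrt P, (IsSelfAdjoint.of_nonneg (CFC.sqrt_nonneg P)).star_eq, CFC.sqrt_mul_sqrt_self P hP,
    fun _ hT => hT.cfcₙ_nnreal _⟩

theorem schur_fintype {ι : Type*} [Fintype ι] (x : ι → 𝔎 →L[ℂ] X) (y : ι → 𝔎 →L[ℂ] Y)
    (hc : ∀ i j k l, Commute ((x i)† ∘L x j) ((y k)† ∘L y l)) (ζ : ι → 𝔎) :
    0 ≤ (∑ i, ∑ j, ⟪ζ i, ((x i)† ∘L x j) (((y i)† ∘L y j) (ζ j))⟫_ℂ).re := by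
  classical
  let p : ι → PiLp 2 (fun _ : ι => 𝔎) →L[ℂ] 𝔎 := fun i => PiLp.proj 2 (fun _ : ι => 𝔎) i
  have hpp : ∀ (i j : ι) (v : 𝔎), p i (((p j)†) v) = if i = j then v else 0 := by
    intro i j v
    refine ext_inner_left ℂ fun w => ?_
    have h1 : ⟪w, p i (((p j)†) v)⟫_ℂ = ⟪p j (((p i)†) w), v⟫_ℂ := by
      rw [← ContinuousLinearMap.adjoint_inner_left, ContinuousLinearMap.adjoint_inner_right]
    have h2 : ((p j)†) v = WithLp.toLp 2 (Pi.single j v) := by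
      refine ext_inner_left ℂ fun u => ?_
      rw [ContinuousLinearMap.adjoint_inner_right, PiLp.inner_apply,
        Finset.sum_eq_single j]
      · simp [p]
      · intro b _ hb
        simp [Pi.single_eq_of_ne hb]
      · simp
    rw [h2]
    simp only [p, PiLp.proj_apply, Pi.single_apply]
  have hpext : ∀ u v : PiLp 2 (fun _ : ι => 𝔎), (∀ k, p k u = p k v) → u = v := by
    intro u v h
    ext k
    exact h k
  have hin : ∀ u v : PiLp 2 (fun _ : ι => 𝔎), ⟪u, v⟫_ℂ = ∑ k, ⟪p k u, p k v⟫_ℂ :=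
    fun u v => PiLp.inner_apply u v
  clear_value p
  let G : PiLp 2 (fun _ : ι => 𝔎) →L[ℂ] X := ∑ i, x i ∘L p i
  have hG : ∀ i v, G (((p i)†) v) = x i v := by
    intro i v
    simp only [G, sum_apply, ContinuousLinearMap.comp_apply, hpp, apply_ite, map_zero]
    simp
  let P := (G)† ∘L G
  have hP : 0 ≤ P := by
    rw [ContinuousLinearMap.nonneg_iff_isPositive]
    exact ContinuousLinearMap.isPositive_adjoint_comp_self G
  obtain ⟨R, hRs, hRR, hRc⟩ := exists_sqrt hP
  let r : ι → 𝔎 →L[ℂ] PiLp 2 (fun _ : ι => 𝔎) := fun i => R ∘L (p i)†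
  have hr : ∀ i j v w, ⟪r i v, r j w⟫_ℂ = ⟪v, ((x i)† ∘L x j) w⟫_ℂ := by
    intro i j v w
    calc ⟪r i v, r j w⟫_ℂ = ⟪((p i)†) v, ((R)† ∘L R) (((p j)†) w)⟫_ℂ := by
          simp [r, ContinuousLinearMap.adjoint_inner_right]
      _ = ⟪((p i)†) v, P (((p j)†) w)⟫_ℂ := by rw [hRs, ← hRR]; rfl
      _ = ⟪G (((p i)†) v), G (((p j)†) w)⟫_ℂ := by
          simp only [P, ContinuousLinearMap.comp_apply, ContinuousLinearMap.adjoint_inner_right]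
      _ = _ := by simp [hG, ContinuousLinearMap.adjoint_inner_right]
  let D : (𝔎 →L[ℂ] 𝔎) → PiLp 2 (fun _ : ι => 𝔎) →L[ℂ] PiLp 2 (fun _ : ι => 𝔎) :=
    fun t => ∑ k, (p k)† ∘L t ∘L p k
  have hD : ∀ t v k, p k (D t v) = t (p k v) := by
    intro t v k
    simp [D, hpp]
  have hDp : ∀ t k v, D t (((p k)†) v) = ((p k)†) (t v) := by
    intro t k v
    refine hpext _ _ fun l => ?_
    rw [hD, hpp, hpp]
    split_ifs <;> simp
  have hsum : ∀ u : PiLp 2 (fun _ : ι => 𝔎), u = ∑ k, ((p k)†) (p k u) := by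
    intro u
    refine hpext _ _ fun l => ?_
    simp [hpp]
  have hPp : ∀ k l v, p k (P (((p l)†) v)) = ((x k)† ∘L x l) v := by
    intro k l v
    refine ext_inner_left ℂ fun w => ?_
    rw [← ContinuousLinearMap.adjoint_inner_left]
    simp only [P, ContinuousLinearMap.comp_apply, ContinuousLinearMap.adjoint_inner_right, hG]
  have hDP : ∀ k l, Commute P (D ((y k)† ∘L y l)) := by
    intro k l
    have h1 : ∀ i v, (P * D ((y k)† ∘L y l)) (((p i)†) v) =
        (D ((y k)† ∘L y l) * P) (((p i)†) v) := by
      intro i v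
      refine hpext _ _ fun m => ?_
      simp only [mul_apply_eq_comp, hDp, hD, hPp]
      exact congrArg (fun T : 𝔎 →L[ℂ] 𝔎 => T v) (hc m i k l).eq
    refine ContinuousLinearMap.ext fun u => ?_
    rw [hsum u, map_sum, map_sum]
    exact Finset.sum_congr rfl fun i _ => h1 i _
  have hDR : ∀ k l, Commute R (D ((y k)† ∘L y l)) := fun k l => hRc _ (hDP k l)
  have hrD : ∀ k l j v, r j (((y k)† ∘L y l) v) = D ((y k)† ∘L y l) (r j v) := by
    intro k l j v
    have := congrArg (fun T : PiLp 2 (fun _ : ι => 𝔎) →L[ℂ] _ => T (((p j)†) v)) (hDR k l).eq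
    simp only [mul_apply_eq_comp, hDp] at this
    exact this
  have hmain : (∑ i, ∑ j, ⟪ζ i, ((x i)† ∘L x j) (((y i)† ∘L y j) (ζ j))⟫_ℂ) =
      ∑ k, ⟪∑ i, y i (p k (r i (ζ i))), ∑ j, y j (p k (r j (ζ j)))⟫_ℂ := by
    have h1 : ∀ i j, ⟪ζ i, ((x i)† ∘L x j) (((y i)† ∘L y j) (ζ j))⟫_ℂ =
        ∑ k, ⟪y i (p k (r i (ζ i))), y j (p k (r j (ζ j)))⟫_ℂ := by
      intro i j
      rw [← hr, hrD, hin]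
      refine Finset.sum_congr rfl fun k _ => ?_
      rw [hD]
      exact ContinuousLinearMap.adjoint_inner_right (y i) _ _
    simp only [h1, sum_inner, inner_sum]
    rw [Finset.sum_congr rfl fun i _ => Finset.sum_comm, Finset.sum_comm]
    exact Finset.sum_congr rfl fun k _ => Finset.sum_comm
  rw [hmain, Complex.re_sum]
  exact Finset.sum_nonneg fun k _ => inner_self_nonneg (𝕜 := ℂ)

theorem kerNonneg_schur {ι : Type*} (x : ι → 𝔎 →L[ℂ] X) (y : ι → 𝔎 →L[ℂ] Y)
    (hc : ∀ i j k l, Commute ((x i)† ∘L x j) ((y k)† ∘L y l)) (ζ : ι → 𝔎) :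
    KerNonneg fun i j => ⟪ζ i, ((x i)† ∘L x j) (((y i)† ∘L y j) (ζ j))⟫_ℂ := by
  intro f
  have h := schur_fintype (fun i : f.support => x i) (fun i : f.support => y i)
    (fun i j k l => hc i j k l) (fun i => f i • ζ i)
  rw [Finset.sum_coe_sort f.support (fun i => ∑ j : f.support,
    ⟪f i • ζ i, ((x i)† ∘L x j) (((y i)† ∘L y j) (f j • ζ j))⟫_ℂ)] at h
  refine h.trans_eq (congrArg Complex.re (Finset.sum_congr rfl fun i _ => ?_))
  rw [Finset.sum_coe_sort f.support (fun j =>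
    ⟪f i • ζ i, ((x i)† ∘L x j) (((y i)† ∘L y j) (f j • ζ j))⟫_ℂ)]
  refine Finset.sum_congr rfl fun j _ => ?_
  rw [map_smul, map_smul, inner_smul_left, inner_smul_right, ← mul_assoc]

/-- The defect operator of a bounded operator `T`. -/
theorem exists_defect (T : X →L[ℂ] Y) :
    ∃ D : X →L[ℂ] X, (D)† ∘L D = ((‖T‖ : ℂ) ^ 2) • ContinuousLinearMap.id ℂ X - (T)† ∘L T := by
  have hpos : 0 ≤ ((‖T‖ : ℂ) ^ 2) • ContinuousLinearMap.id ℂ X - (T)† ∘L T := by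
    rw [ContinuousLinearMap.nonneg_iff_isPositive, ContinuousLinearMap.isPositive_def']
    refine ⟨?_, fun v => ?_⟩
    · refine IsSelfAdjoint.sub (IsSelfAdjoint.smul ?_ (IsSelfAdjoint.one _)) ?_
      · simp [IsSelfAdjoint, ← Complex.ofReal_pow]
      · exact (ContinuousLinearMap.isPositive_adjoint_comp_self T).isSelfAdjoint
    · have h1 : ‖T v‖ ^ 2 ≤ ‖T‖ ^ 2 * ‖v‖ ^ 2 := by
        rw [← mul_pow]
        exact pow_le_pow_left₀ (norm_nonneg _) (T.le_opNorm v) 2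
      have h2 := inner_self_eq_norm_sq (𝕜 := ℂ) v
      have h3 := inner_self_eq_norm_sq (𝕜 := ℂ) (T v)
      simp only [RCLike.re_to_complex] at h2 h3
      rw [ContinuousLinearMap.reApplyInnerSelf_apply]
      simp only [sub_apply, smul_apply, ContinuousLinearMap.comp_apply, inner_sub_left,
        ContinuousLinearMap.adjoint_inner_left, inner_smul_left, ContinuousLinearMap.id_apply,
        RCLike.re_to_complex, Complex.sub_re]
      rw [← Complex.ofReal_pow, Complex.conj_ofReal, Complex.re_ofReal_mul, h2, h3]
      linarith
  obtain ⟨R, hRs, hRR, -⟩ := exists_sqrt hpos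
  exact ⟨R, hRs.symm ▸ hRR⟩

end Schur

/-! ### `C*`-bases and modules over them -/

section Modules

variable {𝔎 H K L : Type*} [NormedAddCommGroup 𝔎] [InnerProductSpace ℂ 𝔎] [CompleteSpace 𝔎]
  [NormedAddCommGroup H] [InnerProductSpace ℂ H] [CompleteSpace H]
  [NormedAddCommGroup K] [InnerProductSpace ℂ K] [CompleteSpace K]
  [NormedAddCommGroup L] [InnerProductSpace ℂ L] [CompleteSpace L]

/-- `(𝔎, B, Bd)` is a `C*`-base: `B` and `Bd` (for `𝔅` and `𝔅†`) are commuting nondegenerate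
`C*`-algebras of operators on the Hilbert space `𝔎`.  The opposite `C*`-base is `(𝔎, Bd, B)`. -/
structure IsCStarBase (B Bd : NonUnitalStarSubalgebra ℂ (𝔎 →L[ℂ] 𝔎)) : Prop where
  isClosed_left : IsClosed (B : Set (𝔎 →L[ℂ] 𝔎))
  isClosed_right : IsClosed (Bd : Set (𝔎 →L[ℂ] 𝔎))
  nondegenerate_left : cspan {ζ | ∃ b ∈ B, ∃ ζ', b ζ' = ζ} = ⊤
  nondegenerate_right : cspan {ζ | ∃ c ∈ Bd, ∃ ζ', c ζ' = ζ} = ⊤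
  commute : ∀ b ∈ B, ∀ c ∈ Bd, Commute b c

/-- A `C*`-`𝔟`-module `H_α`, for the `C*`-base `𝔟 = (𝔎, B, Bd)`: a closed subspace
`α ⊆ L(𝔎, H)` with `[α 𝔎] = H`, `[α B] = α` and `[α* α] = B`. -/
structure BaseModule (B Bd : NonUnitalStarSubalgebra ℂ (𝔎 →L[ℂ] 𝔎)) (H : Type*)
    [NormedAddCommGroup H] [InnerProductSpace ℂ H] [CompleteSpace H] where
  isBase : IsCStarBase B Bd
  space : Submodule ℂ (𝔎 →L[ℂ] H)
  isClosed : IsClosed (space : Set (𝔎 →L[ℂ] H))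
  span_apply : cspan {h | ∃ ξ ∈ space, ∃ ζ, ξ ζ = h} = ⊤
  span_right : cspan {x | ∃ ξ ∈ space, ∃ b ∈ B, ξ ∘L b = x} = space
  span_gram : (cspan {b | ∃ ξ ∈ space, ∃ ξ' ∈ space, (ξ)† ∘L ξ' = b} : Set (𝔎 →L[ℂ] 𝔎)) = B

variable {B Bd : NonUnitalStarSubalgebra ℂ (𝔎 →L[ℂ] 𝔎)}

namespace BaseModule

theorem gram_mem (α : BaseModule B Bd H) {ξ ξ' : 𝔎 →L[ℂ] H} (hξ : ξ ∈ α.space)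
    (hξ' : ξ' ∈ α.space) : (ξ)† ∘L ξ' ∈ B := by
  have : (ξ)† ∘L ξ' ∈ (B : Set (𝔎 →L[ℂ] 𝔎)) := by
    rw [← α.span_gram]
    exact subset_cspan _ ⟨ξ, hξ, ξ', hξ', rfl⟩
  exact this

/-- The vectors `ξ ζ`. -/
def vec (α : BaseModule B Bd H) (p : α.space × 𝔎) : H := (p.1 : 𝔎 →L[ℂ] H) p.2

theorem cspan_vec (α : BaseModule B Bd H) : cspan (Set.range α.vec) = ⊤ := by
  rw [← α.span_apply]
  congr 1
  ext h
  constructor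
  · rintro ⟨⟨⟨ξ, hξ⟩, ζ⟩, rfl⟩
    exact ⟨ξ, hξ, ζ, rfl⟩
  · rintro ⟨ξ, hξ, ζ, rfl⟩
    exact ⟨⟨⟨ξ, hξ⟩, ζ⟩, rfl⟩

theorem comp_mem (α : BaseModule B Bd H) {ξ : 𝔎 →L[ℂ] H} (hξ : ξ ∈ α.space)
    {b : 𝔎 →L[ℂ] 𝔎} (hb : b ∈ B) : ξ ∘L b ∈ α.space := by
  rw [← α.span_right]
  exact subset_cspan _ ⟨ξ, hξ, b, hb, rfl⟩

theorem rho_kernel (α : BaseModule B Bd H) (c : Bd) :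
    KerNonneg fun i j : α.space × 𝔎 => ((‖(c : 𝔎 →L[ℂ] 𝔎)‖ : ℝ) : ℂ) ^ 2 *
      ⟪α.vec i, α.vec j⟫_ℂ -
      ⟪(i.1 : 𝔎 →L[ℂ] H) ((c : 𝔎 →L[ℂ] 𝔎) i.2), (j.1 : 𝔎 →L[ℂ] H) ((c : 𝔎 →L[ℂ] 𝔎) j.2)⟫_ℂ := by
  obtain ⟨c, hc⟩ := c
  obtain ⟨D, hD⟩ := exists_defect c
  have hcc : (c)† ∘L c ∈ Bd := mul_mem (star_mem hc : star c ∈ Bd) hc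
  have h := kerNonneg_schur (ι := α.space × 𝔎) (fun _ => D) (fun i => (i.1 : 𝔎 →L[ℂ] H))
    (fun i j k l => by
      have hg := α.gram_mem k.1.2 l.1.2
      rw [hD]
      exact (((Commute.one_left _).smul_left _).sub_left (α.isBase.commute _ hg _ hcc).symm))
    (fun i => i.2)
  refine (congrArg KerNonneg ?_).mp h
  funext i j
  have hg := (α.isBase.commute _ (α.gram_mem i.1.2 j.1.2) _ (star_mem hc)).eq
  have hg' := congrArg (fun T : 𝔎 →L[ℂ] 𝔎 => T (c j.2)) hg
  have e1 : ((c)†) ((((i.1 : 𝔎 →L[ℂ] H))†) ((j.1 : 𝔎 →L[ℂ] H) (c j.2))) =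
      (((i.1 : 𝔎 →L[ℂ] H))†) ((j.1 : 𝔎 →L[ℂ] H) (((c)†) (c j.2))) := hg'.symm
  have hg2 := congrArg (fun T : 𝔎 →L[ℂ] 𝔎 => T j.2)
    (α.isBase.commute _ (α.gram_mem i.1.2 j.1.2) _ hcc).eq
  have e2 : ((c)†) (c ((((i.1 : 𝔎 →L[ℂ] H))†) ((j.1 : 𝔎 →L[ℂ] H) j.2))) =
      (((i.1 : 𝔎 →L[ℂ] H))†) ((j.1 : 𝔎 →L[ℂ] H) (((c)†) (c j.2))) := hg2.symm
  simp only [hD, vec, sub_apply, smul_apply, ContinuousLinearMap.comp_apply,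
    ContinuousLinearMap.id_apply, inner_sub_right, inner_smul_right, e2]
  rw [ContinuousLinearMap.adjoint_inner_right, ← e1]
  rw [ContinuousLinearMap.adjoint_inner_right, ContinuousLinearMap.adjoint_inner_right]

/-- The representation `ρ_α : 𝔅† → L(H)`, given by `ρ_α(c) (ξ ζ) = ξ (c ζ)`. -/
def rho (α : BaseModule B Bd H) (c : Bd) : H →L[ℂ] H :=
  gramMap α.vec fun p => (p.1 : 𝔎 →L[ℂ] H) ((c : 𝔎 →L[ℂ] 𝔎) p.2)

theorem rho_apply (α : BaseModule B Bd H) (c : Bd) {ξ : 𝔎 →L[ℂ] H} (hξ : ξ ∈ α.space) (ζ : 𝔎) :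
    α.rho c (ξ ζ) = ξ ((c : 𝔎 →L[ℂ] 𝔎) ζ) :=
  gramMap_apply α.cspan_vec (norm_nonneg _) (α.rho_kernel c) (⟨⟨ξ, hξ⟩, ζ⟩ : α.space × 𝔎)

theorem norm_rho_le (α : BaseModule B Bd H) (c : Bd) : ‖α.rho c‖ ≤ ‖(c : 𝔎 →L[ℂ] 𝔎)‖ :=
  norm_gramMap_le α.cspan_vec (norm_nonneg _) (α.rho_kernel c)

theorem ext_vec (α : BaseModule B Bd H) {F : Type*} [NormedAddCommGroup F] [NormedSpace ℂ F]
    {S T : H →L[ℂ] F}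
    (h : ∀ ξ ∈ α.space, ∀ ζ, S (ξ ζ) = T (ξ ζ)) : S = T :=
  ext_of_cspan_eq_top α.cspan_vec fun p => h p.1 p.1.2 p.2

theorem rho_add (α : BaseModule B Bd H) (c d : Bd) : α.rho (c + d) = α.rho c + α.rho d :=
  α.ext_vec fun ξ hξ ζ => by simp [rho_apply _ _ hξ]

theorem rho_smul (α : BaseModule B Bd H) (r : ℂ) (c : Bd) : α.rho (r • c) = r • α.rho c :=
  α.ext_vec fun ξ hξ ζ => by simp [rho_apply _ _ hξ]

theorem rho_sub (α : BaseModule B Bd H) (c d : Bd) : α.rho (c - d) = α.rho c - α.rho d :=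
  α.ext_vec fun ξ hξ ζ => by simp [rho_apply _ _ hξ]

/-- If `Bd` is spanned by `S`, then membership of `ρ_α(c) ξ` in a closed subspace can be tested
on `S`. -/
theorem rho_mem_of_span (α : BaseModule B Bd H) {S : Set (𝔎 →L[ℂ] 𝔎)}
    (hS : (cspan S : Set (𝔎 →L[ℂ] 𝔎)) = Bd) {E : Type*} [NormedAddCommGroup E] [NormedSpace ℂ E]
    (f : (H →L[ℂ] H) →L[ℂ] E) {C : Submodule ℂ E} (hC : IsClosed (C : Set E))
    (h : ∀ c : Bd, (c : 𝔎 →L[ℂ] 𝔎) ∈ S → f (α.rho c) ∈ C) (c : Bd) : f (α.rho c) ∈ C := by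
  have hsub : ∀ b ∈ Submodule.span ℂ S, ∃ hb : b ∈ Bd, f (α.rho ⟨b, hb⟩) ∈ C := by
    intro b hb
    induction hb using Submodule.span_induction with
    | mem b hb =>
      have hb' : b ∈ (Bd : Set (𝔎 →L[ℂ] 𝔎)) := hS ▸ subset_cspan S hb
      exact ⟨hb', h ⟨b, hb'⟩ hb⟩
    | zero =>
      refine ⟨Bd.zero_mem, ?_⟩
      have : α.rho ⟨0, Bd.zero_mem⟩ = 0 := by
        have := α.rho_smul 0 (0 : Bd)
        rwa [zero_smul, zero_smul] at this
      rw [this, map_zero]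
      exact C.zero_mem
    | add x y _ _ hx hy =>
      obtain ⟨hx, hx'⟩ := hx
      obtain ⟨hy, hy'⟩ := hy
      refine ⟨Bd.add_mem hx hy, ?_⟩
      have := α.rho_add ⟨x, hx⟩ ⟨y, hy⟩
      rw [show (⟨x + y, Bd.add_mem hx hy⟩ : Bd) = ⟨x, hx⟩ + ⟨y, hy⟩ from rfl, this, map_add]
      exact C.add_mem hx' hy'
    | smul r x _ hx =>
      obtain ⟨hx, hx'⟩ := hx
      refine ⟨SMulMemClass.smul_mem r hx, ?_⟩
      have := α.rho_smul r ⟨x, hx⟩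
      rw [show (⟨r • x, SMulMemClass.smul_mem r hx⟩ : Bd) = r • ⟨x, hx⟩ from rfl, this, map_smul]
      exact C.smul_mem r hx'
  have hc : (c : 𝔎 →L[ℂ] 𝔎) ∈ closure (Submodule.span ℂ S : Set (𝔎 →L[ℂ] 𝔎)) := by
    have : (c : 𝔎 →L[ℂ] 𝔎) ∈ (cspan S : Set (𝔎 →L[ℂ] 𝔎)) := hS ▸ c.2
    exact this
  obtain ⟨u, hu, hlim⟩ := mem_closure_iff_seq_limit.1 hc
  choose hB hf using fun n => hsub (u n) (hu n)
  have hlim2 : Filter.Tendsto (fun n => α.rho ⟨u n, hB n⟩) Filter.atTop (nhds (α.rho c)) := by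
    rw [tendsto_iff_norm_sub_tendsto_zero] at hlim ⊢
    refine squeeze_zero (fun _ => norm_nonneg _) (fun n => ?_) hlim
    rw [← rho_sub]
    exact α.norm_rho_le _
  exact hC.mem_of_tendsto ((f.continuous.tendsto _).comp hlim2) (Filter.Eventually.of_forall hf)

end BaseModule

/-- The condition `[ρ_α(𝔅†) γ] = γ`. -/
def ActsOn {B' Bd' : NonUnitalStarSubalgebra ℂ (𝔎 →L[ℂ] 𝔎)} (α : BaseModule B Bd H)
    (γ : BaseModule B' Bd' H) : Prop :=
  cspan {x | ∃ c : Bd, ∃ ξ ∈ γ.space, α.rho c ∘L ξ = x} = γ.space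

theorem ActsOn.mem {B' Bd' : NonUnitalStarSubalgebra ℂ (𝔎 →L[ℂ] 𝔎)} {α : BaseModule B Bd H}
    {γ : BaseModule B' Bd' H} (h : ActsOn α γ) (c : Bd) {ξ : 𝔎 →L[ℂ] H} (hξ : ξ ∈ γ.space) :
    α.rho c ∘L ξ ∈ γ.space := by
  have : α.rho c ∘L ξ ∈ cspan {x | ∃ c : Bd, ∃ ξ ∈ γ.space, α.rho c ∘L ξ = x} :=
    subset_cspan _ ⟨c, ξ, hξ, rfl⟩
  rwa [h] at this

theorem ActsOn.commute {B' Bd' : NonUnitalStarSubalgebra ℂ (𝔎 →L[ℂ] 𝔎)} {α : BaseModule B Bd H}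
    {γ : BaseModule B' Bd' H} (h : ActsOn α γ) (c : Bd) (d : Bd') (v : H) :
    α.rho c (γ.rho d v) = γ.rho d (α.rho c v) := by
  have : α.rho c ∘L γ.rho d = γ.rho d ∘L α.rho c := γ.ext_vec fun ξ hξ ζ => by
    have h1 := γ.rho_apply d (h.mem c hξ) ζ
    simp only [ContinuousLinearMap.comp_apply] at h1 ⊢
    rw [γ.rho_apply d hξ, h1]
  exact congrArg (fun T : H →L[ℂ] H => T v) this

/-- The push-forward `[S α]` of a module along a set `S` of operators whose elements satisfy
`[S H] = X` and `[S* S α] = α`. -/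
def BaseModule.push (α : BaseModule B Bd H) (S : Set (H →L[ℂ] K))
    (h1 : cspan {k | ∃ s ∈ S, ∃ v, s v = k} = ⊤)
    (h2 : cspan {x | ∃ s ∈ S, ∃ t ∈ S, ∃ ξ ∈ α.space, ((s)† ∘L t) ∘L ξ = x} = α.space) :
    BaseModule B Bd K where
  isBase := α.isBase
  space := cspan {x | ∃ s ∈ S, ∃ ξ ∈ α.space, s ∘L ξ = x}
  isClosed := isClosed_cspan _
  span_apply := by
    refine cspan_eq_top_of_forall h1 ?_
    rintro _ ⟨s, hs, v, rfl⟩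
    refine cspan_map_mem s (isClosed_cspan _) (S := {h | ∃ ξ ∈ α.space, ∃ ζ, ξ ζ = h}) ?_ v
      (by rw [α.span_apply]; trivial)
    rintro _ ⟨ξ, hξ, ζ, rfl⟩
    exact subset_cspan _ ⟨s ∘L ξ, subset_cspan _ ⟨s, hs, ξ, hξ, rfl⟩, ζ, rfl⟩
  span_right := by
    refine le_antisymm (cspan_le (isClosed_cspan _) ?_) (cspan_le (isClosed_cspan _) ?_)
    · rintro _ ⟨x, hx, b, hb, rfl⟩
      refine cspan_map_mem ((ContinuousLinearMap.compL ℂ 𝔎 𝔎 K).flip b) (isClosed_cspan _) ?_ x hx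
      rintro _ ⟨s, hs, ξ, hξ, rfl⟩
      exact subset_cspan _ ⟨s, hs, ξ ∘L b, α.comp_mem hξ hb, rfl⟩
    · rintro _ ⟨s, hs, ξ, hξ, rfl⟩
      rw [← α.span_right] at hξ
      refine cspan_map_mem (ContinuousLinearMap.compL ℂ 𝔎 H K s) (isClosed_cspan _) ?_ ξ hξ
      rintro _ ⟨ξ, hξ, b, hb, rfl⟩
      exact subset_cspan _ ⟨s ∘L ξ, subset_cspan _ ⟨s, hs, ξ, hξ, rfl⟩, b, hb, rfl⟩
  span_gram := by
    rw [← α.span_gram]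
    refine congrArg _ (le_antisymm (cspan_le (isClosed_cspan _) ?_) (cspan_le (isClosed_cspan _) ?_))
    · have key : ∀ x ∈ cspan {x | ∃ s ∈ S, ∃ ξ ∈ α.space, s ∘L ξ = x}, ∀ t ∈ S, ∀ ξ' ∈ α.space,
          (ξ')† ∘L ((t)† ∘L x) ∈ cspan {b | ∃ ξ ∈ α.space, ∃ ξ' ∈ α.space, (ξ)† ∘L ξ' = b} := by
        intro x hx t ht ξ' hξ'
        refine cspan_map_mem (ContinuousLinearMap.compL ℂ 𝔎 H 𝔎 ((ξ')†) ∘L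
          ContinuousLinearMap.compL ℂ 𝔎 K H ((t)†)) (isClosed_cspan _) ?_ x hx
        rintro _ ⟨s, hs, ξ, hξ, rfl⟩
        have : (t)† ∘L (s ∘L ξ) ∈ α.space := by
          rw [← h2]
          exact subset_cspan _ ⟨t, ht, s, hs, ξ, hξ, rfl⟩
        exact subset_cspan _ ⟨ξ', hξ', _, this, rfl⟩
      have hB : ∀ z : 𝔎 →L[ℂ] 𝔎,
          z ∈ cspan {b | ∃ ξ ∈ α.space, ∃ ξ' ∈ α.space, (ξ)† ∘L ξ' = b} ↔ z ∈ B := by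
        intro z
        rw [← SetLike.mem_coe, α.span_gram, SetLike.mem_coe]
      rintro _ ⟨y, hy, x, hx, rfl⟩
      have hstar : (x)† ∘L y ∈ cspan {b | ∃ ξ ∈ α.space, ∃ ξ' ∈ α.space, (ξ)† ∘L ξ' = b} := by
        refine cspan_map_mem (ContinuousLinearMap.compL ℂ 𝔎 K 𝔎 ((x)†)) (isClosed_cspan _) ?_ y hy
        rintro _ ⟨t, ht, ξ', hξ', rfl⟩
        have h4 := star_mem ((hB _).1 (key x hx t ht ξ' hξ'))
        refine (hB _).2 ?_
        convert h4 using 1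
        change _ = ((ξ')† ∘L ((t)† ∘L x))†
        simp [ContinuousLinearMap.adjoint_comp, ContinuousLinearMap.comp_assoc]
      have h4 := star_mem ((hB _).1 hstar)
      refine (hB _).2 ?_
      convert h4 using 1
      change _ = ((x)† ∘L y)†
      simp [ContinuousLinearMap.adjoint_comp]
    · rintro _ ⟨ξ, hξ, ξ', hξ', rfl⟩
      rw [← h2] at hξ'
      refine cspan_map_mem (ContinuousLinearMap.compL ℂ 𝔎 H 𝔎 ((ξ)†)) (isClosed_cspan _) ?_ ξ' hξ'
      rintro _ ⟨s, hs, t, ht, η, hη, rfl⟩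
      refine subset_cspan _ ⟨s ∘L ξ, subset_cspan _ ⟨s, hs, ξ, hξ, rfl⟩, t ∘L η,
        subset_cspan _ ⟨t, ht, η, hη, rfl⟩, ?_⟩
      simp [ContinuousLinearMap.adjoint_comp, ContinuousLinearMap.comp_assoc]

/-! ### The relative tensor product -/

/-- The index set of the elementary tensors `ξ ⊗ ζ ⊗ η`. -/
abbrev RTPIndex (β : BaseModule B Bd H) (γ : BaseModule Bd B K) : Type _ :=
  β.space × 𝔎 × γ.space

/-- The kernel `⟨ξ ⊗ ζ ⊗ η | ξ' ⊗ ζ' ⊗ η'⟩ = ⟨ζ | ξ* ξ' η* η' ζ'⟩`. -/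
def rtpKernel (β : BaseModule B Bd H) (γ : BaseModule Bd B K) (p q : RTPIndex β γ) : ℂ :=
  ⟪p.2.1, ((p.1 : 𝔎 →L[ℂ] H)† ∘L (q.1 : 𝔎 →L[ℂ] H))
    (((p.2.2 : 𝔎 →L[ℂ] K)† ∘L (q.2.2 : 𝔎 →L[ℂ] K)) q.2.1)⟫_ℂ

theorem gram_commute (β : BaseModule B Bd H) (γ : BaseModule Bd B K) {ξ ξ' : 𝔎 →L[ℂ] H}
    (hξ : ξ ∈ β.space) (hξ' : ξ' ∈ β.space) {η η' : 𝔎 →L[ℂ] K} (hη : η ∈ γ.space)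
    (hη' : η' ∈ γ.space) : Commute ((ξ)† ∘L ξ') ((η)† ∘L η') :=
  β.isBase.commute _ (β.gram_mem hξ hξ') _ (γ.gram_mem hη hη')

theorem isPSD_rtpKernel (β : BaseModule B Bd H) (γ : BaseModule Bd B K) :
    IsPSD (rtpKernel β γ) where
  conj_symm p q := by
    have h := congrArg (fun T : 𝔎 →L[ℂ] 𝔎 => T p.2.1)
      (gram_commute β γ q.1.2 p.1.2 q.2.2.2 p.2.2.2).eq
    simp only [mul_apply_eq_comp] at h
    simp only [rtpKernel]
    rw [inner_conj_symm, h]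
    simp only [ContinuousLinearMap.comp_apply]
    rw [ContinuousLinearMap.adjoint_inner_left, ← ContinuousLinearMap.adjoint_inner_right,
      ContinuousLinearMap.adjoint_inner_left, ContinuousLinearMap.adjoint_inner_right]
  nonneg := kerNonneg_schur (ι := RTPIndex β γ) (fun p => (p.1 : 𝔎 →L[ℂ] H))
    (fun p => (p.2.2 : 𝔎 →L[ℂ] K))
    (fun i j k l => gram_commute β γ i.1.2 j.1.2 k.2.2.2 l.2.2.2) (fun p => p.2.1)

/-- The relative tensor product `H_β ⊗_𝔟 {}_γ K` of a `C*`-`𝔟`-module `H_β` and a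
`C*`-`𝔟†`-module `K_γ`: the Hilbert space `β ⊗ 𝔎 ⊗ γ` spanned by the elementary tensors
`ξ ⊗ ζ ⊗ η`. -/
def RTP (β : BaseModule B Bd H) (γ : BaseModule Bd B K) : Type _ :=
  GramSpace (isPSD_rtpKernel β γ)

namespace RTP

instance (β : BaseModule B Bd H) (γ : BaseModule Bd B K) : NormedAddCommGroup (RTP β γ) :=
  inferInstanceAs (NormedAddCommGroup (GramSpace (isPSD_rtpKernel β γ)))
instance (β : BaseModule B Bd H) (γ : BaseModule Bd B K) : InnerProductSpace ℂ (RTP β γ) :=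
  inferInstanceAs (InnerProductSpace ℂ (GramSpace (isPSD_rtpKernel β γ)))
instance (β : BaseModule B Bd H) (γ : BaseModule Bd B K) : CompleteSpace (RTP β γ) :=
  inferInstanceAs (CompleteSpace (GramSpace (isPSD_rtpKernel β γ)))

/-- The elementary tensor `ξ ⊗ ζ ⊗ η`, for `p = (ξ, ζ, η)`. -/
def tmul (β : BaseModule B Bd H) (γ : BaseModule Bd B K) (p : RTPIndex β γ) : RTP β γ :=
  GramSpace.gen (isPSD_rtpKernel β γ) p

theorem inner_tmul (β : BaseModule B Bd H) (γ : BaseModule Bd B K) (p q : RTPIndex β γ) :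
    ⟪tmul β γ p, tmul β γ q⟫_ℂ = rtpKernel β γ p q :=
  GramSpace.inner_gen _ p q

theorem cspan_tmul (β : BaseModule B Bd H) (γ : BaseModule Bd B K) :
    cspan (Set.range (tmul β γ)) = ⊤ :=
  GramSpace.cspan_gen _

/-- The flip `ξ ⊗ ζ ⊗ η ↦ η ⊗ ζ ⊗ ξ`. -/
def flip (β : BaseModule B Bd H) (γ : BaseModule Bd B K) : RTP β γ ≃ₗᵢ[ℂ] RTP γ β :=
  gramEquiv (tmul β γ) (fun p => tmul γ β (p.2.2, p.2.1, p.1)) (cspan_tmul β γ)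
    (by
      rw [← cspan_tmul γ β]
      congr 1
      ext v
      constructor
      · rintro ⟨p, rfl⟩
        exact ⟨_, rfl⟩
      · rintro ⟨p, rfl⟩
        exact ⟨(p.2.2, p.2.1, p.1), rfl⟩)
    (fun p q => by
      rw [inner_tmul, inner_tmul]
      exact congrArg (fun T : 𝔎 →L[ℂ] 𝔎 => ⟪p.2.1, T q.2.1⟫_ℂ)
        (gram_commute β γ p.1.2 q.1.2 p.2.2.2 q.2.2.2).eq)

theorem flip_tmul (β : BaseModule B Bd H) (γ : BaseModule Bd B K) (p : RTPIndex β γ) :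
    flip β γ (tmul β γ p) = tmul γ β (p.2.2, p.2.1, p.1) :=
  gramEquiv_apply _ _ _ p

theorem ket_kernel (β : BaseModule B Bd H) (γ : BaseModule Bd B K) (η : γ.space) :
    KerNonneg fun i j : β.space × 𝔎 => ((‖(η : 𝔎 →L[ℂ] K)‖ : ℝ) : ℂ) ^ 2 *
      ⟪β.vec i, β.vec j⟫_ℂ -
      ⟪tmul β γ (i.1, i.2, η), tmul β γ (j.1, j.2, η)⟫_ℂ := by
  obtain ⟨D, hD⟩ := exists_defect (η : 𝔎 →L[ℂ] K)
  have h := kerNonneg_schur (ι := β.space × 𝔎) (fun i => (i.1 : 𝔎 →L[ℂ] H)) (fun _ => D)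
    (fun i j k l => by
      rw [hD]
      exact ((Commute.one_right _).smul_right _).sub_right
        (gram_commute β γ i.1.2 j.1.2 η.2 η.2))
    (fun i => i.2)
  refine (congrArg KerNonneg ?_).mp h
  funext i j
  rw [inner_tmul]
  simp only [hD, rtpKernel, BaseModule.vec, sub_apply, smul_apply, map_sub, map_smul,
    ContinuousLinearMap.comp_apply, ContinuousLinearMap.id_apply, inner_sub_right,
    inner_smul_right]
  rw [ContinuousLinearMap.adjoint_inner_right]

/-- The ket operator `|η⟩₂ : H → H_β ⊗ {}_γ K`, `ξ ζ ↦ ξ ⊗ ζ ⊗ η`. -/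
def ket₂ (β : BaseModule B Bd H) (γ : BaseModule Bd B K) (η : γ.space) : H →L[ℂ] RTP β γ :=
  gramMap β.vec fun p => tmul β γ (p.1, p.2, η)

theorem ket₂_apply (β : BaseModule B Bd H) (γ : BaseModule Bd B K) (η : γ.space) (ξ : β.space)
    (ζ : 𝔎) : ket₂ β γ η ((ξ : 𝔎 →L[ℂ] H) ζ) = tmul β γ (ξ, ζ, η) :=
  gramMap_apply β.cspan_vec (norm_nonneg _) (ket_kernel β γ η) (ξ, ζ)

/-- The ket operator `|ξ⟩₁ : K → H_β ⊗ {}_γ K`, `η ζ ↦ ξ ⊗ ζ ⊗ η`. -/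
def ket₁ (β : BaseModule B Bd H) (γ : BaseModule Bd B K) (ξ : β.space) : K →L[ℂ] RTP β γ :=
  (flip γ β : RTP γ β →L[ℂ] RTP β γ) ∘L ket₂ γ β ξ

theorem ket₁_apply (β : BaseModule B Bd H) (γ : BaseModule Bd B K) (ξ : β.space) (η : γ.space)
    (ζ : 𝔎) : ket₁ β γ ξ ((η : 𝔎 →L[ℂ] K) ζ) = tmul β γ (ξ, ζ, η) := by
  change flip γ β (ket₂ γ β ξ ((η : 𝔎 →L[ℂ] K) ζ)) = _
  rw [ket₂_apply, flip_tmul]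

theorem adjoint_ket₂_comp (β : BaseModule B Bd H) (γ : BaseModule Bd B K) (η η' : γ.space) :
    (ket₂ β γ η)† ∘L ket₂ β γ η' =
      β.rho ⟨(η : 𝔎 →L[ℂ] K)† ∘L (η' : 𝔎 →L[ℂ] K), γ.gram_mem η.2 η'.2⟩ := by
  refine β.ext_vec fun ξ' hξ' ζ' => ?_
  refine ext_inner_left ℂ fun v => ?_
  have key : (innerSL ℂ (((ket₂ β γ η)† ∘L ket₂ β γ η') (ξ' ζ'))) =
      innerSL ℂ (β.rho ⟨(η : 𝔎 →L[ℂ] K)† ∘L (η' : 𝔎 →L[ℂ] K), γ.gram_mem η.2 η'.2⟩ (ξ' ζ')) := by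
    refine β.ext_vec fun ξ hξ ζ => ?_
    rw [innerSL_apply_apply, innerSL_apply_apply]
    refine (inner_conj_symm _ _).symm.trans ((congrArg conj ?_).trans (inner_conj_symm _ _))
    have h1 := ket₂_apply β γ η' ⟨ξ', hξ'⟩ ζ'
    have h2 := ket₂_apply β γ η ⟨ξ, hξ⟩ ζ
    simp only at h1 h2
    rw [ContinuousLinearMap.comp_apply, ContinuousLinearMap.adjoint_inner_right, h1, h2,
      β.rho_apply _ hξ', inner_tmul, rtpKernel, ContinuousLinearMap.comp_apply,
      ContinuousLinearMap.adjoint_inner_right]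
  have := congrArg (fun T : H →L[ℂ] ℂ => conj (T v)) key
  simpa [innerSL_apply_apply, inner_conj_symm] using this

theorem adjoint_ket₁_comp (β : BaseModule B Bd H) (γ : BaseModule Bd B K) (ξ ξ' : β.space) :
    (ket₁ β γ ξ)† ∘L ket₁ β γ ξ' =
      γ.rho ⟨(ξ : 𝔎 →L[ℂ] H)† ∘L (ξ' : 𝔎 →L[ℂ] H), β.gram_mem ξ.2 ξ'.2⟩ := by
  rw [← adjoint_ket₂_comp γ β ξ ξ']
  refine ContinuousLinearMap.ext fun v => ext_inner_left ℂ fun w => ?_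
  simp only [ContinuousLinearMap.comp_apply, ContinuousLinearMap.adjoint_inner_right, ket₁]
  exact (flip γ β).inner_map_map _ _

theorem cspan_ket₂ (β : BaseModule B Bd H) (γ : BaseModule Bd B K) :
    cspan {x | ∃ s ∈ Set.range (ket₂ β γ), ∃ v, s v = x} = ⊤ := by
  refine cspan_eq_top_of_forall (cspan_tmul β γ) ?_
  rintro _ ⟨⟨ξ, ζ, η⟩, rfl⟩
  exact subset_cspan _ ⟨_, ⟨η, rfl⟩, (ξ : 𝔎 →L[ℂ] H) ζ, ket₂_apply β γ η ξ ζ⟩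

theorem cspan_ket₁ (β : BaseModule B Bd H) (γ : BaseModule Bd B K) :
    cspan {x | ∃ s ∈ Set.range (ket₁ β γ), ∃ v, s v = x} = ⊤ := by
  refine cspan_eq_top_of_forall (cspan_tmul β γ) ?_
  rintro _ ⟨⟨ξ, ζ, η⟩, rfl⟩
  exact subset_cspan _ ⟨_, ⟨ξ, rfl⟩, (η : 𝔎 →L[ℂ] K) ζ, ket₁_apply β γ ξ η ζ⟩

variable {B' Bd' : NonUnitalStarSubalgebra ℂ (𝔎 →L[ℂ] 𝔎)}

/-- The module structure `α ◁ γ = [|γ⟩₂ α]` on `H_β ⊗ {}_γ K`, for a `C*`-module `H_α`. -/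
def ltri (α : BaseModule B' Bd' H) (β : BaseModule B Bd H) (γ : BaseModule Bd B K)
    (h : ActsOn β α) : BaseModule B' Bd' (RTP β γ) :=
  α.push (Set.range (ket₂ β γ)) (cspan_ket₂ β γ) (by
    refine le_antisymm (cspan_le α.isClosed ?_) ?_
    · rintro _ ⟨_, ⟨η, rfl⟩, _, ⟨η', rfl⟩, ξ, hξ, rfl⟩
      rw [adjoint_ket₂_comp]
      exact h.mem _ hξ
    · rw [← h]
      refine cspan_le (isClosed_cspan _) ?_
      rintro _ ⟨c, ξ, hξ, rfl⟩
      refine β.rho_mem_of_span γ.span_gram ((ContinuousLinearMap.compL ℂ 𝔎 H H).flip ξ)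
        (isClosed_cspan _) ?_ c
      rintro ⟨_, hc⟩ ⟨η, hη, η', hη', rfl⟩
      refine subset_cspan _ ⟨_, ⟨⟨η, hη⟩, rfl⟩, _, ⟨⟨η', hη'⟩, rfl⟩, ξ, ?_, ?_⟩
      · rw [h]
        exact hξ
      · rw [adjoint_ket₂_comp]
        rfl)

/-- The module structure `β ▷ δ = [|β⟩₁ δ]` on `H_β ⊗ {}_γ K`, for a `C*`-module `K_δ`. -/
def rtri (β : BaseModule B Bd H) (γ : BaseModule Bd B K) (δ : BaseModule B' Bd' K)
    (h : ActsOn γ δ) : BaseModule B' Bd' (RTP β γ) :=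
  δ.push (Set.range (ket₁ β γ)) (cspan_ket₁ β γ) (by
    refine le_antisymm (cspan_le δ.isClosed ?_) ?_
    · rintro _ ⟨_, ⟨η, rfl⟩, _, ⟨η', rfl⟩, ξ, hξ, rfl⟩
      rw [adjoint_ket₁_comp]
      exact h.mem _ hξ
    · rw [← h]
      refine cspan_le (isClosed_cspan _) ?_
      rintro _ ⟨c, ξ, hξ, rfl⟩
      refine γ.rho_mem_of_span β.span_gram ((ContinuousLinearMap.compL ℂ 𝔎 K K).flip ξ)
        (isClosed_cspan _) ?_ c
      rintro ⟨_, hc⟩ ⟨η, hη, η', hη', rfl⟩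
      refine subset_cspan _ ⟨_, ⟨⟨η, hη⟩, rfl⟩, _, ⟨⟨η', hη'⟩, rfl⟩, ξ, ?_, ?_⟩
      · rw [h]
        exact hξ
      · rw [adjoint_ket₁_comp]
        rfl)

end RTP

/-! ### Functoriality with respect to unitaries, and associativity -/

/-- The relation `W α = γ`, for a unitary `W`. -/
def Intertwines {B' Bd' : NonUnitalStarSubalgebra ℂ (𝔎 →L[ℂ] 𝔎)} (W : H ≃ₗᵢ[ℂ] K)
    (α : BaseModule B Bd H) (γ : BaseModule B' Bd' K) : Prop :=
  (fun ξ : 𝔎 →L[ℂ] H => (W : H →L[ℂ] K) ∘L ξ) '' (α.space : Set (𝔎 →L[ℂ] H)) = γ.space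

namespace Intertwines

variable {W : H ≃ₗᵢ[ℂ] K} {α : BaseModule B Bd H} {γ : BaseModule B Bd K}

theorem mem (h : Intertwines W α γ) (ξ : α.space) :
    (W : H →L[ℂ] K) ∘L (ξ : 𝔎 →L[ℂ] H) ∈ γ.space :=
  (Set.ext_iff.1 h _).1 ⟨ξ, ξ.2, rfl⟩

theorem of_push {X : Type*} [NormedAddCommGroup X] [InnerProductSpace ℂ X] [CompleteSpace X]
    (W : H ≃ₗᵢ[ℂ] K) (α : BaseModule B Bd X) {S : Set (X →L[ℂ] H)} {T : Set (X →L[ℂ] K)}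
    (h1 : cspan {k | ∃ s ∈ S, ∃ v, s v = k} = ⊤)
    (h2 : cspan {x | ∃ s ∈ S, ∃ t ∈ S, ∃ ξ ∈ α.space, ((s)† ∘L t) ∘L ξ = x} = α.space)
    (h1' : cspan {k | ∃ s ∈ T, ∃ v, s v = k} = ⊤)
    (h2' : cspan {x | ∃ s ∈ T, ∃ t ∈ T, ∃ ξ ∈ α.space, ((s)† ∘L t) ∘L ξ = x} = α.space)
    (hST : ∀ s ∈ S, (W : H →L[ℂ] K) ∘L s ∈ T)
    (hTS : ∀ t ∈ T, (W.symm : K →L[ℂ] H) ∘L t ∈ S) :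
    Intertwines W (α.push S h1 h2) (α.push T h1' h2') := by
  refine Set.Subset.antisymm ?_ ?_
  · rintro _ ⟨x, hx, rfl⟩
    refine cspan_map_mem (ContinuousLinearMap.compL ℂ 𝔎 H K (W : H →L[ℂ] K)) (isClosed_cspan _)
      ?_ x hx
    rintro _ ⟨s, hs, ξ, hξ, rfl⟩
    exact subset_cspan _ ⟨_, hST s hs, ξ, hξ, rfl⟩
  · intro y hy
    refine ⟨(W.symm : K →L[ℂ] H) ∘L y, ?_, ?_⟩
    · refine cspan_map_mem (ContinuousLinearMap.compL ℂ 𝔎 K H (W.symm : K →L[ℂ] H))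
        (isClosed_cspan _) ?_ y hy
      rintro _ ⟨t, ht, ξ, hξ, rfl⟩
      exact subset_cspan _ ⟨_, hTS t ht, ξ, hξ, rfl⟩
    · ext v
      simp

end Intertwines

namespace RTP

variable {B₂ Bd₂ : NonUnitalStarSubalgebra ℂ (𝔎 →L[ℂ] 𝔎)}

theorem flip_flip (β : BaseModule B Bd H) (γ : BaseModule Bd B K) (v : RTP β γ) :
    flip γ β (flip β γ v) = v := by
  have : ((flip γ β : RTP γ β →L[ℂ] RTP β γ) ∘L (flip β γ : RTP β γ →L[ℂ] RTP γ β)) =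
      ContinuousLinearMap.id ℂ _ := by
    refine ext_of_cspan_eq_top (cspan_tmul β γ) fun p => ?_
    change flip γ β (flip β γ (tmul β γ p)) = tmul β γ p
    rw [flip_tmul, flip_tmul]
  exact congrArg (fun T : RTP β γ →L[ℂ] RTP β γ => T v) this

theorem flip_intertwines_rtri (β : BaseModule B Bd H) (γ : BaseModule Bd B K)
    (δ : BaseModule B₂ Bd₂ K) (h : ActsOn γ δ) :
    Intertwines (flip β γ) (rtri β γ δ h) (ltri δ γ β h) := by
  refine Intertwines.of_push _ _ _ _ _ _ ?_ ?_
  · rintro _ ⟨ξ, rfl⟩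
    refine ⟨ξ, ?_⟩
    ext v
    exact (flip_flip γ β _).symm
  · rintro _ ⟨ξ, rfl⟩
    refine ⟨ξ, ?_⟩
    ext v
    refine (flip β γ).injective ?_
    change flip β γ (flip γ β _) = flip β γ ((flip β γ).symm _)
    rw [LinearIsometryEquiv.apply_symm_apply, flip_flip]

theorem flip_intertwines_ltri (α : BaseModule B₂ Bd₂ H) (β : BaseModule B Bd H)
    (γ : BaseModule Bd B K) (h : ActsOn β α) :
    Intertwines (flip β γ) (ltri α β γ h) (rtri γ β α h) := by
  refine Intertwines.of_push _ _ _ _ _ _ ?_ ?_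
  · rintro _ ⟨η, rfl⟩
    exact ⟨η, rfl⟩
  · rintro _ ⟨η, rfl⟩
    refine ⟨η, ?_⟩
    ext v
    exact ((flip β γ).symm_apply_apply _).symm

/-- The unitary `W ⊗ 1 : ξ ⊗ ζ ⊗ η ↦ W ξ ⊗ ζ ⊗ η`, for a unitary `W` with `W β = β'`. -/
def mapLeft (W : H ≃ₗᵢ[ℂ] L) {β : BaseModule B Bd H} {β' : BaseModule B Bd L}
    (hW : Intertwines W β β') (γ : BaseModule Bd B K) : RTP β γ ≃ₗᵢ[ℂ] RTP β' γ :=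
  gramEquiv (tmul β γ) (fun p => tmul β' γ (⟨_, hW.mem p.1⟩, p.2.1, p.2.2)) (cspan_tmul β γ)
    (by
      rw [← cspan_tmul β' γ]
      congr 1
      ext v
      constructor
      · rintro ⟨p, rfl⟩
        exact ⟨_, rfl⟩
      · rintro ⟨⟨⟨ξ', hξ'⟩, ζ, η⟩, rfl⟩
        obtain ⟨ξ, hξ, rfl⟩ := (Set.ext_iff.1 hW ξ').2 hξ'
        exact ⟨(⟨ξ, hξ⟩, ζ, η), rfl⟩)
    (fun p q => by
      rw [inner_tmul, inner_tmul]
      simp only [rtpKernel]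
      refine congrArg (fun T : 𝔎 →L[ℂ] 𝔎 => ⟪p.2.1, T
        (((p.2.2 : 𝔎 →L[ℂ] K)† ∘L (q.2.2 : 𝔎 →L[ℂ] K)) q.2.1)⟫_ℂ) ?_
      refine ContinuousLinearMap.ext fun v => ext_inner_left ℂ fun w => ?_
      simp only [ContinuousLinearMap.comp_apply, ContinuousLinearMap.adjoint_inner_right]
      exact (W.inner_map_map _ _).symm)

theorem mapLeft_tmul (W : H ≃ₗᵢ[ℂ] L) {β : BaseModule B Bd H} {β' : BaseModule B Bd L}
    (hW : Intertwines W β β') (γ : BaseModule Bd B K) (p : RTPIndex β γ) :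
    mapLeft W hW γ (tmul β γ p) = tmul β' γ (⟨_, hW.mem p.1⟩, p.2.1, p.2.2) :=
  gramEquiv_apply _ _ _ p

/-- The unitary `1 ⊗ W : ξ ⊗ ζ ⊗ η ↦ ξ ⊗ ζ ⊗ W η`, for a unitary `W` with `W γ = γ'`. -/
def mapRight (β : BaseModule B Bd H) (W : K ≃ₗᵢ[ℂ] L) {γ : BaseModule Bd B K}
    {γ' : BaseModule Bd B L} (hW : Intertwines W γ γ') : RTP β γ ≃ₗᵢ[ℂ] RTP β γ' :=
  ((flip β γ).trans (mapLeft W hW β)).trans (flip γ' β)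

theorem mapRight_tmul (β : BaseModule B Bd H) (W : K ≃ₗᵢ[ℂ] L) {γ : BaseModule Bd B K}
    {γ' : BaseModule Bd B L} (hW : Intertwines W γ γ') (p : RTPIndex β γ) :
    mapRight β W hW (tmul β γ p) = tmul β γ' (p.1, p.2.1, ⟨_, hW.mem p.2.2⟩) := by
  simp only [mapRight, LinearIsometryEquiv.trans_apply]
  rw [flip_tmul, mapLeft_tmul, flip_tmul]

section Assoc

variable (β : BaseModule B Bd H) (γ : BaseModule Bd B K) (ε : BaseModule B₂ Bd₂ K)
  (φ : BaseModule Bd₂ B₂ L) (h₁ : ActsOn γ ε) (h₂ : ActsOn ε γ)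

theorem rho_rtri (c : Bd₂) (ξ : β.space) (k : K) :
    (rtri β γ ε h₁).rho c (ket₁ β γ ξ k) = ket₁ β γ ξ (ε.rho c k) := by
  have : (rtri β γ ε h₁).rho c ∘L ket₁ β γ ξ = ket₁ β γ ξ ∘L ε.rho c := by
    refine ε.ext_vec fun x hx ζ => ?_
    have hm : ket₁ β γ ξ ∘L x ∈ (rtri β γ ε h₁).space := subset_cspan _ ⟨_, ⟨ξ, rfl⟩, x, hx, rfl⟩
    have := (rtri β γ ε h₁).rho_apply c hm ζ
    simp only [ContinuousLinearMap.comp_apply] at this ⊢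
    rw [this, ε.rho_apply c hx]
  exact congrArg (fun T : K →L[ℂ] RTP β γ => T k) this

theorem rho_ltri (c : B) (η : φ.space) (k : K) :
    (ltri γ ε φ h₂).rho c (ket₂ ε φ η k) = ket₂ ε φ η (γ.rho c k) := by
  have : (ltri γ ε φ h₂).rho c ∘L ket₂ ε φ η = ket₂ ε φ η ∘L γ.rho c := by
    refine γ.ext_vec fun x hx ζ => ?_
    have hm : ket₂ ε φ η ∘L x ∈ (ltri γ ε φ h₂).space :=
      subset_cspan _ ⟨_, ⟨η, rfl⟩, x, hx, rfl⟩
    have := (ltri γ ε φ h₂).rho_apply c hm ζ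
    simp only [ContinuousLinearMap.comp_apply] at this ⊢
    rw [this, γ.rho_apply c hx]
  exact congrArg (fun T : K →L[ℂ] RTP ε φ => T k) this

theorem inner_ket₂ (η η' : γ.space) (v w : H) :
    ⟪ket₂ β γ η v, ket₂ β γ η' w⟫_ℂ =
      ⟪v, β.rho ⟨(η : 𝔎 →L[ℂ] K)† ∘L (η' : 𝔎 →L[ℂ] K), γ.gram_mem η.2 η'.2⟩ w⟫_ℂ := by
  rw [← adjoint_ket₂_comp, ContinuousLinearMap.comp_apply, ContinuousLinearMap.adjoint_inner_right]

theorem inner_ket₁ (ξ ξ' : β.space) (v w : K) :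
    ⟪ket₁ β γ ξ v, ket₁ β γ ξ' w⟫_ℂ =
      ⟪v, γ.rho ⟨(ξ : 𝔎 →L[ℂ] H)† ∘L (ξ' : 𝔎 →L[ℂ] H), β.gram_mem ξ.2 ξ'.2⟩ w⟫_ℂ := by
  rw [← adjoint_ket₁_comp, ContinuousLinearMap.comp_apply, ContinuousLinearMap.adjoint_inner_right]

/-- The associativity isomorphism
`(H_β ⊗ {}_γ K)_{β ▷ ε} ⊗ {}_φ L ≅ H_β ⊗ {}_{γ ◁ φ} (K_ε ⊗ {}_φ L)`: both spaces are identified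
with `β ⊗ K ⊗ φ`, that is, `|η⟩₂ |ξ⟩₁ k ↦ |ξ⟩₁ |η⟩₂ k` for `ξ ∈ β`, `k ∈ K`, `η ∈ φ`. -/
def assoc : RTP (rtri β γ ε h₁) φ ≃ₗᵢ[ℂ] RTP β (ltri γ ε φ h₂) :=
  gramEquiv (ι := β.space × K × φ.space)
    (fun p => ket₂ (rtri β γ ε h₁) φ p.2.2 (ket₁ β γ p.1 p.2.1))
    (fun p => ket₁ β (ltri γ ε φ h₂) p.1 (ket₂ ε φ p.2.2 p.2.1))
    (by
      refine cspan_eq_top_of_forall (cspan_ket₂ (rtri β γ ε h₁) φ) ?_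
      rintro _ ⟨_, ⟨η, rfl⟩, v, rfl⟩
      refine cspan_map_mem (ket₂ (rtri β γ ε h₁) φ η) (isClosed_cspan _) ?_ v
        (by rw [cspan_ket₁ β γ]; trivial)
      rintro _ ⟨_, ⟨ξ, rfl⟩, k, rfl⟩
      exact subset_cspan _ ⟨(ξ, k, η), rfl⟩)
    (by
      refine cspan_eq_top_of_forall (cspan_ket₁ β (ltri γ ε φ h₂)) ?_
      rintro _ ⟨_, ⟨ξ, rfl⟩, v, rfl⟩
      refine cspan_map_mem (ket₁ β (ltri γ ε φ h₂) ξ) (isClosed_cspan _) ?_ v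
        (by rw [cspan_ket₂ ε φ]; trivial)
      rintro _ ⟨_, ⟨η, rfl⟩, k, rfl⟩
      exact subset_cspan _ ⟨(ξ, k, η), rfl⟩)
    (fun p q => by
      rw [inner_ket₂, rho_rtri, inner_ket₁, inner_ket₁, rho_ltri, inner_ket₂, h₁.commute])

theorem assoc_apply (ξ : β.space) (k : K) (η : φ.space) :
    assoc β γ ε φ h₁ h₂ (ket₂ (rtri β γ ε h₁) φ η (ket₁ β γ ξ k)) =
      ket₁ β (ltri γ ε φ h₂) ξ (ket₂ ε φ η k) :=
  gramEquiv_apply (ι := β.space × K × φ.space) _ _ _ (ξ, k, η)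

end Assoc

end RTP

/-! ### `C*`-pseudo-multiplicative unitaries -/

/-- `(H, βh, α, β)` is a `C*`-`(𝔟†, 𝔟, 𝔟†)`-module. -/
structure IsTriModule (βh : BaseModule Bd B H) (α : BaseModule B Bd H) (β : BaseModule Bd B H) :
    Prop where
  βh_α : ActsOn βh α
  βh_β : ActsOn βh β
  α_βh : ActsOn α βh
  α_β : ActsOn α β
  β_βh : ActsOn β βh
  β_α : ActsOn β α

section PMU

open RTP

variable {βh : BaseModule Bd B H} {α : BaseModule B Bd H} {β : BaseModule Bd B H}

/-- The leg operator `V₁₃` from `H_βh ⊗ {}_{α ▷ α} (H_α ⊗ {}_β H)` to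
`(H_βh ⊗ {}_α H)_{α ◁ α} ⊗ {}_β H`, for a unitary `V` with `V (βh ▷ β) = βh ◁ β`: exchange the
second and the third leg, apply `V ⊗ 1`, and exchange the legs again. -/
def leg₁₃ (hm : IsTriModule βh α β) (V : RTP βh α ≃ₗᵢ[ℂ] RTP α β)
    (hV : Intertwines V (rtri βh α β hm.α_β) (ltri βh α β hm.α_βh)) :
    RTP βh (rtri α β α hm.β_α) ≃ₗᵢ[ℂ] RTP (ltri α βh α hm.βh_α) β :=
  (mapRight βh (flip α β) (flip_intertwines_rtri α β α hm.β_α)).trans <|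
  (assoc βh α β α hm.α_β hm.β_α).symm.trans <|
  (mapLeft V hV α).trans <|
  (mapLeft (flip α β) (flip_intertwines_ltri βh α β hm.α_βh) α).trans <|
  (assoc β α βh α hm.α_βh hm.βh_α).trans <|
  flip β (ltri α βh α hm.βh_α)

/-- `V : H_βh ⊗_{𝔟†} {}_α H → H_α ⊗_𝔟 {}_β H` is a `C*`-pseudo-multiplicative unitary: it satisfies
the four intertwining relations and the pentagon equation `V₂₃ V₁₂ = V₁₂ V₁₃ V₂₃`. -/
structure IsPMU (hm : IsTriModule βh α β) (V : RTP βh α ≃ₗᵢ[ℂ] RTP α β) : Prop where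
  map_α_α : Intertwines V (ltri α βh α hm.βh_α) (rtri α β α hm.β_α)
  map_βh_β : Intertwines V (rtri βh α β hm.α_β) (ltri βh α β hm.α_βh)
  map_βh_βh : Intertwines V (rtri βh α βh hm.α_βh) (rtri α β βh hm.β_βh)
  map_β_α : Intertwines V (ltri β βh α hm.βh_β) (ltri β α β hm.α_β)
  pentagon : ∀ x : RTP (rtri βh α βh hm.α_βh) α,
    mapRight α V map_β_α (assoc α β βh α hm.β_βh hm.βh_β (mapLeft V map_βh_βh α x)) =
      assoc α β α β hm.β_α hm.α_β
        (mapLeft V map_α_α β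
          (leg₁₃ hm V map_βh_β
            (mapRight βh V map_α_α (assoc βh α βh α hm.α_βh hm.βh_α x))))

/-- The right leg `A(V) = [⟨α|₁ V |βh⟩₁]`. -/
def legA (V : RTP βh α ≃ₗᵢ[ℂ] RTP α β) : Submodule ℂ (H →L[ℂ] H) :=
  cspan {a | ∃ (ξ : α.space) (η : βh.space),
    (ket₁ α β ξ)† ∘L (V : RTP βh α →L[ℂ] RTP α β) ∘L ket₁ βh α η = a}

/-- The left leg `Â(V) = [⟨β|₂ V |α⟩₂]`. -/
def legAhat (V : RTP βh α ≃ₗᵢ[ℂ] RTP α β) : Submodule ℂ (H →L[ℂ] H) :=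
  cspan {a | ∃ (η : β.space) (ξ : α.space),
    (ket₂ α β η)† ∘L (V : RTP βh α →L[ℂ] RTP α β) ∘L ket₂ βh α ξ = a}

/-- The closed span `[α α*]` of the operators `ξ ξ'*`. -/
def BaseModule.compacts {B Bd : NonUnitalStarSubalgebra ℂ (𝔎 →L[ℂ] 𝔎)} (α : BaseModule B Bd H) :
    Submodule ℂ (H →L[ℂ] H) :=
  cspan {a | ∃ ξ ∈ α.space, ∃ ξ' ∈ α.space, ξ ∘L (ξ')† = a}

/-- Regularity: `[⟨α|₁ V |α⟩₂] = [α α*]`. -/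
def IsRegular (V : RTP βh α ≃ₗᵢ[ℂ] RTP α β) : Prop :=
  cspan {a | ∃ ξ ξ' : α.space,
    (ket₁ α β ξ)† ∘L (V : RTP βh α →L[ℂ] RTP α β) ∘L ket₂ βh α ξ' = a} = α.compacts

end PMU

/-! ### `C*`-pseudo-Kac systems -/

/-- `(H, αh, βh, α, β)` is a `C*`-`(𝔟, 𝔟†, 𝔟, 𝔟†)`-module. -/
structure IsQuadModule (αh : BaseModule B Bd H) (βh : BaseModule Bd B H) (α : BaseModule B Bd H)
    (β : BaseModule Bd B H) : Prop where
  αh_βh : ActsOn αh βh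
  αh_α : ActsOn αh α
  αh_β : ActsOn αh β
  βh_αh : ActsOn βh αh
  βh_α : ActsOn βh α
  βh_β : ActsOn βh β
  α_αh : ActsOn α αh
  α_βh : ActsOn α βh
  α_β : ActsOn α β
  β_αh : ActsOn β αh
  β_βh : ActsOn β βh
  β_α : ActsOn β α

/-- Morphisms of `C*`-modules: `T α ⊆ γ` and `T* γ ⊆ α`. -/
def IsMorphism {B' Bd' : NonUnitalStarSubalgebra ℂ (𝔎 →L[ℂ] 𝔎)} (T : H →L[ℂ] K)
    (α : BaseModule B Bd H) (γ : BaseModule B' Bd' K) : Prop :=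
  (∀ ξ ∈ α.space, T ∘L ξ ∈ γ.space) ∧ ∀ η ∈ γ.space, (T)† ∘L η ∈ α.space

section Kac

open RTP

variable {αh : BaseModule B Bd H} {βh : BaseModule Bd B H} {α : BaseModule B Bd H}
  {β : BaseModule Bd B H}

namespace IsQuadModule

theorem tri (hm : IsQuadModule αh βh α β) : IsTriModule βh α β :=
  ⟨hm.βh_α, hm.βh_β, hm.α_βh, hm.α_β, hm.β_βh, hm.β_α⟩

theorem triCheck (hm : IsQuadModule αh βh α β) : IsTriModule αh βh α :=
  ⟨hm.αh_βh, hm.αh_α, hm.βh_αh, hm.βh_α, hm.α_αh, hm.α_βh⟩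

theorem triHat (hm : IsQuadModule αh βh α β) : IsTriModule α β αh :=
  ⟨hm.α_β, hm.α_αh, hm.β_α, hm.β_αh, hm.αh_α, hm.αh_β⟩

end IsQuadModule

variable (αh βh α β) in
/-- `U` is a symmetry (`U = U* = U⁻¹`) and a morphism from `(H, αh, βh)` to `(H, α, β)`. -/
structure IsSymmetry (U : H ≃ₗᵢ[ℂ] H) : Prop where
  involutive : ∀ x, U (U x) = x
  map_αh : IsMorphism (U : H →L[ℂ] H) αh α
  map_βh : IsMorphism (U : H →L[ℂ] H) βh β

namespace IsSymmetry

theorem intertwines_of_isMorphism {U : H ≃ₗᵢ[ℂ] H} (hU : ∀ x, U (U x) = x)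
    {B' Bd' : NonUnitalStarSubalgebra ℂ (𝔎 →L[ℂ] 𝔎)} {γ δ : BaseModule B' Bd' H}
    (h : IsMorphism (U : H →L[ℂ] H) γ δ) : Intertwines U γ δ ∧ Intertwines U δ γ := by
  have hadj : ((U : H →L[ℂ] H))† = (U : H →L[ℂ] H) := by
    refine ContinuousLinearMap.ext fun v => ext_inner_left ℂ fun w => ?_
    rw [ContinuousLinearMap.adjoint_inner_right]
    have := U.inner_map_map w (U v)
    rwa [hU] at this
  have hcomp : ∀ ξ : 𝔎 →L[ℂ] H, (U : H →L[ℂ] H) ∘L ((U : H →L[ℂ] H) ∘L ξ) = ξ := fun ξ => by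
    ext v
    exact hU _
  obtain ⟨h1, h2⟩ := h
  rw [hadj] at h2
  constructor
  · refine Set.Subset.antisymm ?_ fun y hy => ⟨_, h2 y hy, hcomp y⟩
    rintro _ ⟨x, hx, rfl⟩
    exact h1 x hx
  · refine Set.Subset.antisymm ?_ fun y hy => ⟨_, h1 y hy, hcomp y⟩
    rintro _ ⟨x, hx, rfl⟩
    exact h2 x hx

variable {U : H ≃ₗᵢ[ℂ] H}

theorem αh_α (hU : IsSymmetry αh βh α β U) : Intertwines U αh α :=
  (intertwines_of_isMorphism hU.involutive hU.map_αh).1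

theorem α_αh (hU : IsSymmetry αh βh α β U) : Intertwines U α αh :=
  (intertwines_of_isMorphism hU.involutive hU.map_αh).2

theorem βh_β (hU : IsSymmetry αh βh α β U) : Intertwines U βh β :=
  (intertwines_of_isMorphism hU.involutive hU.map_βh).1

theorem β_βh (hU : IsSymmetry αh βh α β U) : Intertwines U β βh :=
  (intertwines_of_isMorphism hU.involutive hU.map_βh).2

end IsSymmetry

/-- `V̌ = Σ (1 ⊗ U) V (1 ⊗ U) Σ : H_αh ⊗ {}_βh H → H_βh ⊗ {}_α H`. -/
def checkV {U : H ≃ₗᵢ[ℂ] H} (hU : IsSymmetry αh βh α β U) (V : RTP βh α ≃ₗᵢ[ℂ] RTP α β) :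
    RTP αh βh ≃ₗᵢ[ℂ] RTP βh α :=
  (flip αh βh).trans <| (mapRight βh U hU.αh_α).trans <| V.trans <|
    (mapRight α U hU.β_βh).trans <| flip α βh

/-- `V̂ = Σ (U ⊗ 1) V (U ⊗ 1) Σ : H_α ⊗ {}_β H → H_β ⊗ {}_αh H`. -/
def hatV {U : H ≃ₗᵢ[ℂ] H} (hU : IsSymmetry αh βh α β U) (V : RTP βh α ≃ₗᵢ[ℂ] RTP α β) :
    RTP α β ≃ₗᵢ[ℂ] RTP β αh :=
  (flip α β).trans <| (mapLeft U hU.β_βh α).trans <| V.trans <|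
    (mapLeft U hU.α_αh β).trans <| flip αh β

/-- `Σ (1 ⊗ U) V : H_βh ⊗ {}_α H → H_βh ⊗ {}_α H`. -/
def kacOp {U : H ≃ₗᵢ[ℂ] H} (hU : IsSymmetry αh βh α β U) (V : RTP βh α ≃ₗᵢ[ℂ] RTP α β) :
    RTP βh α ≃ₗᵢ[ℂ] RTP βh α :=
  V.trans <| (mapRight α U hU.β_βh).trans <| flip α βh

/-- `(V, U)` is a balanced `C*`-pseudo-multiplicative unitary. -/
structure IsBalancedPMU (hm : IsQuadModule αh βh α β) (V : RTP βh α ≃ₗᵢ[ℂ] RTP α β)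
    (U : H ≃ₗᵢ[ℂ] H) : Prop where
  symmetry : IsSymmetry αh βh α β U
  pmu : IsPMU hm.tri V
  pmu_check : IsPMU hm.triCheck (checkV symmetry V)
  pmu_hat : IsPMU hm.triHat (hatV symmetry V)

/-- `(V, U)` is a `C*`-pseudo-Kac system: a balanced `C*`-pseudo-multiplicative unitary such that
`V`, `V̌`, `V̂` are regular and `(Σ (1 ⊗ U) V)³ = 1`. -/
structure IsPseudoKacSystem (hm : IsQuadModule αh βh α β) (V : RTP βh α ≃ₗᵢ[ℂ] RTP α β)
    (U : H ≃ₗᵢ[ℂ] H) : Prop extends IsBalancedPMU hm V U where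
  regular : IsRegular V
  regular_check : IsRegular (checkV symmetry V)
  regular_hat : IsRegular (hatV symmetry V)
  cube : ∀ x, kacOp symmetry V (kacOp symmetry V (kacOp symmetry V x)) = x

end Kac

end Modules

end PseudoKac

end

noncomputable section

namespace PseudoKac

/-! ### Products and adjoints of sets of operators -/

section OpMul

variable {E F G X : Type*} [NormedAddCommGroup E] [NormedSpace ℂ E]
  [NormedAddCommGroup F] [NormedSpace ℂ F] [NormedAddCommGroup G] [NormedSpace ℂ G]
  [NormedAddCommGroup X] [NormedSpace ℂ X]

/-! Everything is moved to right legs and then absorbed. Substituting `U` in both slots gives `Â_V =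
A_{V̌}` (`legAhat_eq`), so `Â` is the right leg of the regular unitary `V̌`. With this,

`[A Â] = [⟨α|₁ V |α̂-free leg⟩ Â]` takes the explicit form `[⟨α|₁ V |β̂⟩₁ Â] = [⟨α|₁ V V̌ |α̂⟩₁ Â] =
[α̂ α̂* Â] = [α̂ α̂*]`.

The second equality is the absorption rule `[|α⟩₁ A_W] = [W |β̂⟩₁ A_W]`, valid for every regular
`C*`-pseudo-multiplicative unitary `W` (`cspan_ket₁_legA`) and applied to `W = V̌`. The third holds
because the cube relation turns `⟨ξ|₁ V V̌ |ξ'⟩₁` into `U (⟨Uξ'|₁ V |ξ⟩₂)* U`, and regularity of `V`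
makes these span `U [α α*] U = [α̂ α̂*]` (`cspan_bra_V_checkV_ket`). The last is the adjoint of `[Â*
α̂] = α̂` (`cspan_adjoint_legA_comp`).

For the absorption rule, write the pentagon equation as `W₁₂* W₂₃ W₁₂ = W₁₃ W₂₃`, apply it to `|ω⟩₁`
with `ω ∈ β̂ ▷ β̂`, and compress the second leg by `⟨ξ|₂`. On the right, `ω = |η⟩₁ η'` gives `W |η⟩₁
⟨ξ|₁ W |η'⟩₁`, and these operators span `[W |β̂⟩₁ A]`. On the left, `W ω` runs through `α ▷ β̂`, and
`W ω = |ξ'⟩₁ η` gives `(⟨ξ|₂ W* |ξ'⟩₁ ⊗ 1) W |η⟩₁`. By regularity the first factors span `[α α*] ⊗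
1`, and `x y* ⊗ 1 = |x⟩₁ ⟨y|₁` (`ket₁_comp_adjoint_ket₁`), so the left side spans `[|α⟩₁ ⟨α|₁ W
|β̂⟩₁] = [|α⟩₁ A]`.

The amplification `T ⊗ 1` exists only for `T` commuting with the representations `ρ`, so such
intertwiners are treated first. -/

theorem cspan_mono {S T : Set E} (h : S ⊆ T) : cspan S ≤ cspan T :=
  cspan_le (isClosed_cspan T) (h.trans (subset_cspan T))

theorem cspan_coe {C : Submodule ℂ E} (hC : IsClosed (C : Set E)) : cspan (C : Set E) = C :=
  le_antisymm (cspan_le hC subset_rfl) (subset_cspan (C : Set E))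

/-- A bounded linear map on a submodule `M` maps `M ∩ [S]` into a closed submodule `C` if it maps
`S ⊆ M` into `C`. -/
theorem map_mem_of_mem_cspan {M : Submodule ℂ E} (g : M →L[ℂ] F) {S : Set E} (hS : S ⊆ M)
    {C : Submodule ℂ F} (hC : IsClosed (C : Set F)) (h : ∀ s (hs : s ∈ S), g ⟨s, hS hs⟩ ∈ C)
    (x : M) (hx : (x : E) ∈ cspan S) : g x ∈ C := by
  have hspan : ∀ y ∈ Submodule.span ℂ S, ∃ hy : y ∈ M, g ⟨y, hy⟩ ∈ C := by
    intro y hy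
    induction hy using Submodule.span_induction with
    | mem y hy => exact ⟨hS hy, h y hy⟩
    | zero => exact ⟨M.zero_mem, (map_zero g).symm ▸ C.zero_mem⟩
    | add y z _ _ hy hz =>
      exact ⟨M.add_mem hy.1 hz.1, (map_add g ⟨y, hy.1⟩ ⟨z, hz.1⟩).symm ▸ C.add_mem hy.2 hz.2⟩
    | smul r y _ hy =>
      exact ⟨M.smul_mem r hy.1, (map_smul g r ⟨y, hy.1⟩).symm ▸ C.smul_mem r hy.2⟩
  -- Closures in `M` are traces of closures in `E`, and the span of `S` already lies in `M`; hence
  -- `M` need not be closed.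
  have hx' : x ∈ closure {y : M | (y : E) ∈ Submodule.span ℂ S} := by
    rw [closure_subtype]
    refine closure_mono ?_ (show (x : E) ∈ closure (Submodule.span ℂ S : Set E) from hx)
    intro y hy
    exact ⟨⟨y, (hspan y hy).1⟩, hy, rfl⟩
  have h2 : closure {y : M | (y : E) ∈ Submodule.span ℂ S} ⊆ g ⁻¹' (C : Set F) :=
    closure_minimal (fun y hy => (hspan y hy).2) (hC.preimage g.continuous)
  exact h2 hx'

/-- The set of products `f g` with `f ∈ S`, `g ∈ T`. -/
def opMul (S : Set (F →L[ℂ] G)) (T : Set (E →L[ℂ] F)) : Set (E →L[ℂ] G) :=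
  Set.image2 (fun f g => f ∘L g) S T

theorem opMul_assoc (R : Set (G →L[ℂ] X)) (S : Set (F →L[ℂ] G)) (T : Set (E →L[ℂ] F)) :
    opMul (opMul R S) T = opMul R (opMul S T) :=
  Set.image2_assoc fun _ _ _ => rfl

theorem cspan_opMul_left (S : Set (F →L[ℂ] G)) (T : Set (E →L[ℂ] F)) :
    cspan (opMul (cspan S : Set (F →L[ℂ] G)) T) = cspan (opMul S T) := by
  refine le_antisymm (cspan_le (isClosed_cspan _) ?_)
    (cspan_mono (Set.image2_subset_right (subset_cspan S)))
  rintro _ ⟨f, hf, g, hg, rfl⟩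
  exact cspan_map_mem ((ContinuousLinearMap.compL ℂ E F G).flip g) (isClosed_cspan _)
    (fun s hs => subset_cspan (opMul S T) ⟨s, hs, g, hg, rfl⟩) f hf

theorem cspan_opMul_right (S : Set (F →L[ℂ] G)) (T : Set (E →L[ℂ] F)) :
    cspan (opMul S (cspan T : Set (E →L[ℂ] F))) = cspan (opMul S T) := by
  refine le_antisymm (cspan_le (isClosed_cspan _) ?_)
    (cspan_mono (Set.image2_subset_left (subset_cspan T)))
  rintro _ ⟨f, hf, g, hg, rfl⟩
  exact cspan_map_mem (ContinuousLinearMap.compL ℂ E F G f) (isClosed_cspan _)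
    (fun s hs => subset_cspan (opMul S T) ⟨f, hf, s, hs, rfl⟩) g hg

theorem cspan_opMul_congr_left {S S' : Set (F →L[ℂ] G)} (h : cspan S = cspan S')
    (T : Set (E →L[ℂ] F)) : cspan (opMul S T) = cspan (opMul S' T) := by
  rw [← cspan_opMul_left, h, cspan_opMul_left]

theorem cspan_opMul_congr_right (S : Set (F →L[ℂ] G)) {T T' : Set (E →L[ℂ] F)}
    (h : cspan T = cspan T') : cspan (opMul S T) = cspan (opMul S T') := by
  rw [← cspan_opMul_right, h, cspan_opMul_right]

end OpMul

section Adjoint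

variable {E F G : Type*} [NormedAddCommGroup E] [InnerProductSpace ℂ E] [CompleteSpace E]
  [NormedAddCommGroup F] [InnerProductSpace ℂ F] [CompleteSpace F]
  [NormedAddCommGroup G] [InnerProductSpace ℂ G] [CompleteSpace G]

/-- The set of adjoints of the elements of `S`. -/
def opAdj (S : Set (E →L[ℂ] F)) : Set (F →L[ℂ] E) :=
  (fun f => (f)†) '' S

theorem opAdj_opAdj (S : Set (E →L[ℂ] F)) : opAdj (opAdj S) = S := by
  simp [opAdj, Set.image_image]

theorem opAdj_opMul (S : Set (F →L[ℂ] G)) (T : Set (E →L[ℂ] F)) :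
    opAdj (opMul S T) = opMul (opAdj T) (opAdj S) :=
  Set.image_image2_antidistrib fun f g => ContinuousLinearMap.adjoint_comp f g

/-- The adjoint is conjugate-linear, so `cspan_map_mem` does not apply; instead the preimage of a
closed subspace under this isometry is again a closed subspace. -/
theorem adjoint_mem_cspan {S : Set (E →L[ℂ] F)} {x : E →L[ℂ] F} (hx : x ∈ cspan S) :
    (x)† ∈ cspan (opAdj S) := by
  let C : Submodule ℂ (E →L[ℂ] F) := (cspan (opAdj S)).comap
    ((ContinuousLinearMap.adjoint : (E →L[ℂ] F) ≃ₗᵢ⋆[ℂ] (F →L[ℂ] E)).toLinearEquiv :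
      (E →L[ℂ] F) →ₗ⋆[ℂ] (F →L[ℂ] E))
  have hC : IsClosed (C : Set (E →L[ℂ] F)) := (isClosed_cspan (opAdj S)).preimage
    (ContinuousLinearMap.adjoint : (E →L[ℂ] F) ≃ₗᵢ⋆[ℂ] (F →L[ℂ] E)).continuous
  exact cspan_le hC (fun s hs => subset_cspan (opAdj S) ⟨s, hs, rfl⟩) hx

theorem cspan_opAdj_congr {S T : Set (E →L[ℂ] F)} (h : cspan S = cspan T) :
    cspan (opAdj S) = cspan (opAdj T) := by
  refine le_antisymm (cspan_le (isClosed_cspan _) ?_) (cspan_le (isClosed_cspan _) ?_)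
  · rintro _ ⟨s, hs, rfl⟩
    exact adjoint_mem_cspan (h ▸ subset_cspan S hs)
  · rintro _ ⟨s, hs, rfl⟩
    exact adjoint_mem_cspan (h ▸ subset_cspan T hs)

theorem adjoint_eq_symm (W : E ≃ₗᵢ[ℂ] F) : ((W : E →L[ℂ] F))† = (W.symm : F →L[ℂ] E) := by
  refine ContinuousLinearMap.ext fun v => ext_inner_left ℂ fun w => ?_
  rw [ContinuousLinearMap.adjoint_inner_right]
  have := W.inner_map_map w (W.symm v)
  rwa [LinearIsometryEquiv.apply_symm_apply] at this

end Adjoint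

theorem kerNonneg_inner {ι E : Type*} [NormedAddCommGroup E] [InnerProductSpace ℂ E]
    (x : ι → E) : KerNonneg fun i j => ⟪x i, x j⟫_ℂ := by
  intro f
  rw [← inner_linearCombination]
  exact inner_self_nonneg (𝕜 := ℂ)

/-! ### Intertwiners and the operators `T ⊗ 1` -/

section Modules

variable {𝔎 H K L : Type*} [NormedAddCommGroup 𝔎] [InnerProductSpace ℂ 𝔎] [CompleteSpace 𝔎]
  [NormedAddCommGroup H] [InnerProductSpace ℂ H] [CompleteSpace H]
  [NormedAddCommGroup K] [InnerProductSpace ℂ K] [CompleteSpace K]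
  [NormedAddCommGroup L] [InnerProductSpace ℂ L] [CompleteSpace L]

variable {B Bd B₂ Bd₂ : NonUnitalStarSubalgebra ℂ (𝔎 →L[ℂ] 𝔎)}

/-- On vectors `ξ ζ` and `ξ' ζ'` the identity says that `ξ* ξ' ∈ B` commutes with `c ∈ Bd`; density
is then used in each variable separately. -/
theorem BaseModule.adjoint_rho (α : BaseModule B Bd H) (c : Bd) :
    (α.rho c)† = α.rho (star c) := by
  symm
  rw [ContinuousLinearMap.eq_adjoint_iff]
  have key : ∀ ξ ∈ α.space, ∀ ζ, ∀ ξ' ∈ α.space, ∀ ζ',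
      ⟪α.rho (star c) (ξ ζ), ξ' ζ'⟫_ℂ = ⟪ξ ζ, α.rho c (ξ' ζ')⟫_ℂ := by
    intro ξ hξ ζ ξ' hξ' ζ'
    have h := congrArg (fun T : 𝔎 →L[ℂ] 𝔎 => T ζ')
      (α.isBase.commute _ (α.gram_mem hξ hξ') _ c.2).eq
    simp only [mul_apply_eq_comp, ContinuousLinearMap.comp_apply] at h
    rw [α.rho_apply _ hξ, α.rho_apply _ hξ', ← ContinuousLinearMap.adjoint_inner_right ξ,
      ← ContinuousLinearMap.adjoint_inner_right ξ, h]
    exact ContinuousLinearMap.adjoint_inner_left _ _ _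
  intro v w
  have h1 : ∀ ξ ∈ α.space, ∀ ζ, ⟪α.rho (star c) (ξ ζ), w⟫_ℂ = ⟪ξ ζ, α.rho c w⟫_ℂ := by
    intro ξ hξ ζ
    have : innerSL ℂ (α.rho (star c) (ξ ζ)) = innerSL ℂ (ξ ζ) ∘L α.rho c :=
      α.ext_vec fun ξ' hξ' ζ' => key ξ hξ ζ ξ' hξ' ζ'
    exact congrArg (fun T : H →L[ℂ] ℂ => T w) this
  have h2 : innerSL ℂ w ∘L α.rho (star c) = innerSL ℂ (α.rho c w) :=
    α.ext_vec fun ξ hξ ζ => by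
      have := congrArg conj (h1 ξ hξ ζ)
      rwa [inner_conj_symm, inner_conj_symm] at this
  have := congrArg conj (congrArg (fun T : H →L[ℂ] ℂ => T v) h2)
  simp only [ContinuousLinearMap.comp_apply, innerSL_apply_apply] at this
  rwa [inner_conj_symm, inner_conj_symm] at this

/-- The space of bounded operators that intertwine the representations `ρ_α` and `ρ_γ`. -/
def intertwiners (α : BaseModule B Bd H) (γ : BaseModule B Bd K) : Submodule ℂ (H →L[ℂ] K) where
  carrier := {T | ∀ (c : Bd) (v : H), T (α.rho c v) = γ.rho c (T v)}
  zero_mem' c v := by simp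
  add_mem' hS hT c v := by simp [hS c v, hT c v]
  smul_mem' r T hT c v := by simp [hT c v]

section Intertwiners

variable {α : BaseModule B Bd H} {γ : BaseModule B Bd K} {δ : BaseModule B Bd L}

/-- Take adjoints in the relation for `star c`; the representations respect the involution by
`adjoint_rho`. -/
theorem intertwiners_adjoint {T : H →L[ℂ] K} (hT : T ∈ intertwiners α γ) :
    (T)† ∈ intertwiners γ α := by
  intro c v
  refine ext_inner_left ℂ fun w => ?_
  have h1 := γ.adjoint_rho (star c)
  have h2 := α.adjoint_rho (star c)
  rw [star_star] at h1 h2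
  rw [ContinuousLinearMap.adjoint_inner_right, ← h1, ← h2, ContinuousLinearMap.adjoint_inner_right,
    ContinuousLinearMap.adjoint_inner_right, ContinuousLinearMap.adjoint_inner_right, hT]

theorem intertwiners_comp {S : K →L[ℂ] L} {T : H →L[ℂ] K} (hS : S ∈ intertwiners γ δ)
    (hT : T ∈ intertwiners α γ) : S ∘L T ∈ intertwiners α δ := fun c v => by
  simp only [ContinuousLinearMap.comp_apply]
  rw [hT, hS]

theorem Intertwines.rho_apply {W : H ≃ₗᵢ[ℂ] K} (h : Intertwines W α γ) (c : Bd) (v : H) :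
    W (α.rho c v) = γ.rho c (W v) := by
  have : (W : H →L[ℂ] K) ∘L α.rho c = γ.rho c ∘L (W : H →L[ℂ] K) := α.ext_vec fun ξ hξ ζ => by
    have h1 := γ.rho_apply c (h.mem ⟨ξ, hξ⟩) ζ
    simp only [ContinuousLinearMap.comp_apply] at h1 ⊢
    rw [h1, α.rho_apply c hξ]
  exact congrArg (fun T : H →L[ℂ] K => T v) this

theorem Intertwines.mem_intertwiners {W : H ≃ₗᵢ[ℂ] K} (h : Intertwines W α γ) :
    (W : H →L[ℂ] K) ∈ intertwiners α γ := fun c v => h.rho_apply c v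

theorem Intertwines.symm_mem {W : H ≃ₗᵢ[ℂ] K} (h : Intertwines W α γ) {x : 𝔎 →L[ℂ] K}
    (hx : x ∈ γ.space) : (W.symm : K →L[ℂ] H) ∘L x ∈ α.space := by
  obtain ⟨ξ, hξ, rfl⟩ := (Set.ext_iff.1 h x).2 hx
  have : (W.symm : K →L[ℂ] H) ∘L ((W : H →L[ℂ] K) ∘L ξ) = ξ := by
    ext v
    exact W.symm_apply_apply _
  exact this.symm ▸ hξ

end Intertwiners

/-! ### Ket operators, amplifications of intertwiners, and associativity -/

namespace RTP

theorem norm_ket₂_le (β : BaseModule B Bd H) (γ : BaseModule Bd B K) (η : γ.space) :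
    ‖ket₂ β γ η‖ ≤ ‖(η : 𝔎 →L[ℂ] K)‖ :=
  norm_gramMap_le β.cspan_vec (norm_nonneg _) (ket_kernel β γ η)

theorem ext_tmul {β : BaseModule B Bd H} {γ : BaseModule Bd B K} {F : Type*}
    [NormedAddCommGroup F] [NormedSpace ℂ F] {S T : RTP β γ →L[ℂ] F}
    (h : ∀ p, S (tmul β γ p) = T (tmul β γ p)) : S = T :=
  ext_of_cspan_eq_top (cspan_tmul β γ) h

theorem ext_ket₂ {β : BaseModule B Bd H} {γ : BaseModule Bd B K} {F : Type*}
    [NormedAddCommGroup F] [NormedSpace ℂ F] {S T : RTP β γ →L[ℂ] F}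
    (h : ∀ η v, S (ket₂ β γ η v) = T (ket₂ β γ η v)) : S = T :=
  ext_tmul fun p => by
    have h1 := ket₂_apply β γ p.2.2 p.1 p.2.1
    have h2 := h p.2.2 ((p.1 : 𝔎 →L[ℂ] H) p.2.1)
    rwa [h1] at h2

theorem ext_ket₁ {β : BaseModule B Bd H} {γ : BaseModule Bd B K} {F : Type*}
    [NormedAddCommGroup F] [NormedSpace ℂ F] {S T : RTP β γ →L[ℂ] F}
    (h : ∀ ξ v, S (ket₁ β γ ξ v) = T (ket₁ β γ ξ v)) : S = T :=
  ext_tmul fun p => by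
    have h1 := ket₁_apply β γ p.1 p.2.2 p.2.1
    have h2 := h p.1 ((p.2.2 : 𝔎 →L[ℂ] K) p.2.1)
    rwa [h1] at h2

theorem flip_ket₂ (β : BaseModule B Bd H) (γ : BaseModule Bd B K) (η : γ.space) (v : H) :
    flip β γ (ket₂ β γ η v) = ket₁ γ β η v := rfl

theorem flip_ket₁ (β : BaseModule B Bd H) (γ : BaseModule Bd B K) (ξ : β.space) (v : K) :
    flip β γ (ket₁ β γ ξ v) = ket₂ γ β ξ v :=
  flip_flip γ β _

/-- `ξ ↦ |ξ⟩₁` as a bounded linear map. -/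
def ket₁L (β : BaseModule B Bd H) (γ : BaseModule Bd B K) :
    β.space →L[ℂ] (K →L[ℂ] RTP β γ) :=
  LinearMap.mkContinuous
    { toFun := fun ξ => ket₁ β γ ξ
      map_add' := fun ξ ξ' => γ.ext_vec fun η hη ζ => by
        have h := fun ξ => ket₁_apply β γ ξ ⟨η, hη⟩ ζ
        have h' := fun ξ => ket₂_apply β γ ⟨η, hη⟩ ξ ζ
        simp only at h
        rw [add_apply, h, h, h, ← h', ← h', ← h']
        simp
      map_smul' := fun r ξ => γ.ext_vec fun η hη ζ => by
        have h := fun ξ => ket₁_apply β γ ξ ⟨η, hη⟩ ζ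
        have h' := fun ξ => ket₂_apply β γ ⟨η, hη⟩ ξ ζ
        simp only at h
        rw [smul_apply, h, h, ← h', ← h']
        simp } 1
    (fun ξ => by
      rw [one_mul]
      refine (ContinuousLinearMap.opNorm_comp_le _ _).trans ?_
      refine (mul_le_of_le_one_left (norm_nonneg _) ?_).trans (norm_ket₂_le γ β ξ)
      exact (flip γ β).toLinearIsometry.norm_toContinuousLinearMap_le)

/-- Both sides send `η' ζ` to `ξ (η* η' ζ)`, the left one because `⟨η|₂ |η'⟩₂ = ρ_β(η* η')`. This is
how rank-one type operators `ξ η*` arise from kets of different legs. -/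
theorem adjoint_ket₂_ket₁ (β : BaseModule B Bd H) (γ : BaseModule Bd B K) (ξ : β.space)
    (η : γ.space) :
    (ket₂ β γ η)† ∘L ket₁ β γ ξ = (ξ : 𝔎 →L[ℂ] H) ∘L (η : 𝔎 →L[ℂ] K)† :=
  γ.ext_vec fun η' hη' ζ => by
    have h1 := ket₁_apply β γ ξ ⟨η', hη'⟩ ζ
    have h2 := ket₂_apply β γ ⟨η', hη'⟩ ξ ζ
    have h3 := congrArg (fun T : H →L[ℂ] H => T ((ξ : 𝔎 →L[ℂ] H) ζ))
      (adjoint_ket₂_comp β γ η ⟨η', hη'⟩)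
    simp only [ContinuousLinearMap.comp_apply] at h1 h2 h3 ⊢
    rw [h1, ← h2, h3, β.rho_apply _ ξ.2]
    rfl

theorem adjoint_ket₁_ket₂ (β : BaseModule B Bd H) (γ : BaseModule Bd B K) (ξ : β.space)
    (η : γ.space) :
    (ket₁ β γ ξ)† ∘L ket₂ β γ η = (η : 𝔎 →L[ℂ] K) ∘L (ξ : 𝔎 →L[ℂ] H)† := by
  have := congrArg (fun T => (T)†) (adjoint_ket₂_ket₁ β γ ξ η)
  simpa [ContinuousLinearMap.adjoint_comp] using this

section TensorLeft

variable {α : BaseModule B Bd H} {α' : BaseModule B Bd K}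
  {M : Type*} [NormedAddCommGroup M] [InnerProductSpace ℂ M] [CompleteSpace M]
  (γ : BaseModule Bd B M)

theorem cspan_range_ket₂ (α : BaseModule B Bd H) :
    cspan (Set.range fun p : γ.space × H => ket₂ α γ p.1 p.2) = ⊤ := by
  rw [← cspan_ket₂ α γ]
  congr 1
  ext v
  constructor
  · rintro ⟨p, rfl⟩
    exact ⟨_, ⟨p.1, rfl⟩, p.2, rfl⟩
  · rintro ⟨_, ⟨η, rfl⟩, h, rfl⟩
    exact ⟨(η, h), rfl⟩

/-- This is the bound `‖T ⊗ 1‖ ≤ ‖T‖` in kernel form. The defect `‖T‖² - T* T` commutes with `ρ_α`,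
hence so does its square root `R`, and the kernel is the Gram kernel of the vectors `|η⟩₂ R h`. -/
theorem intertwiner_kernel {T : H →L[ℂ] K} (hT : T ∈ intertwiners α α') :
    KerNonneg fun i j : γ.space × H => ((‖T‖ : ℝ) : ℂ) ^ 2 *
      ⟪ket₂ α γ i.1 i.2, ket₂ α γ j.1 j.2⟫_ℂ -
      ⟪ket₂ α' γ i.1 (T i.2), ket₂ α' γ j.1 (T j.2)⟫_ℂ := by
  obtain ⟨D, hD⟩ := exists_defect T
  have hpos : 0 ≤ (D)† ∘L D := by
    rw [ContinuousLinearMap.nonneg_iff_isPositive]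
    exact ContinuousLinearMap.isPositive_adjoint_comp_self D
  -- `exists_defect` does not say what `D` commutes with, so a second root is taken, one that
  -- commutes with everything commuting with `D* D`.
  obtain ⟨R, hRs, hRR, hRc⟩ := exists_sqrt hpos
  have hcomm : ∀ (c : Bd) (v : H), R (α.rho c v) = α.rho c (R v) := by
    intro c v
    have h1 : Commute ((D)† ∘L D) (α.rho c) := by
      refine ContinuousLinearMap.ext fun v => ?_
      have := intertwiners_comp (intertwiners_adjoint hT) hT c v
      simp only [ContinuousLinearMap.comp_apply] at this
      simp [hD, mul_apply_eq_comp, this]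
    exact congrArg (fun S : H →L[ℂ] H => S v) (hRc _ h1).eq
  refine (congrArg KerNonneg ?_).mp (kerNonneg_inner fun p : γ.space × H => ket₂ α γ p.1 (R p.2))
  funext i j
  rw [inner_ket₂, inner_ket₂, inner_ket₂, ← hcomm, ← hT]
  nth_rewrite 1 [← hRs]
  rw [ContinuousLinearMap.adjoint_inner_left, ← mul_apply_eq_comp, hRR, hD]
  simp [inner_sub_right, inner_smul_right, ContinuousLinearMap.adjoint_inner_right]

/-- The operator `T ⊗ 1 : |η⟩₂ h ↦ |η⟩₂ (T h)`, as a bounded linear map in the intertwiner `T`. -/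
def tensorLeft (α : BaseModule B Bd H) (α' : BaseModule B Bd K) :
    intertwiners α α' →L[ℂ] (RTP α γ →L[ℂ] RTP α' γ) :=
  have happ : ∀ (T : intertwiners α α') (p : γ.space × H), _ := fun T p =>
    gramMap_apply (cspan_range_ket₂ γ α) (norm_nonneg _) (intertwiner_kernel γ T.2) p
  LinearMap.mkContinuous
    { toFun := fun T => gramMap (fun p : γ.space × H => ket₂ α γ p.1 p.2)
        fun p => ket₂ α' γ p.1 ((T : H →L[ℂ] K) p.2)
      map_add' := fun S T => ext_of_cspan_eq_top (cspan_range_ket₂ γ α) fun p => by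
        have := happ (S + T) p
        rw [add_apply, happ S p, happ T p]
        exact this.trans (map_add (ket₂ α' γ p.1) _ _)
      map_smul' := fun r T => ext_of_cspan_eq_top (cspan_range_ket₂ γ α) fun p => by
        have := happ (r • T) p
        rw [smul_apply, happ T p]
        exact this.trans (map_smul (ket₂ α' γ p.1) _ _) } 1
    (fun T => by
      rw [one_mul]
      exact norm_gramMap_le (cspan_range_ket₂ γ α) (norm_nonneg _) (intertwiner_kernel γ T.2))

theorem tensorLeft_ket₂ (T : intertwiners α α') (η : γ.space) (v : H) :
    tensorLeft γ α α' T (ket₂ α γ η v) = ket₂ α' γ η ((T : H →L[ℂ] K) v) :=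
  gramMap_apply (cspan_range_ket₂ γ α) (norm_nonneg _) (intertwiner_kernel γ T.2) (η, v)

theorem mapLeft_ket₂ {W : H ≃ₗᵢ[ℂ] K} (hW : Intertwines W α α') (η : γ.space) (v : H) :
    mapLeft W hW γ (ket₂ α γ η v) = ket₂ α' γ η (W v) := by
  have : (mapLeft W hW γ : RTP α γ →L[ℂ] RTP α' γ) ∘L ket₂ α γ η =
      ket₂ α' γ η ∘L (W : H →L[ℂ] K) := α.ext_vec fun ξ hξ ζ => by
    have h1 := ket₂_apply α γ η ⟨ξ, hξ⟩ ζ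
    have h2 := ket₂_apply α' γ η ⟨_, hW.mem ⟨ξ, hξ⟩⟩ ζ
    simp only [ContinuousLinearMap.comp_apply] at h1 h2 ⊢
    rw [h1]
    exact (mapLeft_tmul W hW γ _).trans h2.symm
  exact congrArg (fun T : H →L[ℂ] RTP α' γ => T v) this

theorem mapLeft_ket₁ {W : H ≃ₗᵢ[ℂ] K} (hW : Intertwines W α α') (ξ : α.space) (v : M) :
    mapLeft W hW γ (ket₁ α γ ξ v) = ket₁ α' γ ⟨_, hW.mem ξ⟩ v := by
  have : (mapLeft W hW γ : RTP α γ →L[ℂ] RTP α' γ) ∘L ket₁ α γ ξ =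
      ket₁ α' γ ⟨_, hW.mem ξ⟩ := γ.ext_vec fun η hη ζ => by
    have h1 := ket₁_apply α γ ξ ⟨η, hη⟩ ζ
    have h2 := ket₁_apply α' γ ⟨_, hW.mem ξ⟩ ⟨η, hη⟩ ζ
    simp only [ContinuousLinearMap.comp_apply] at h1 h2 ⊢
    rw [h1, h2]
    exact mapLeft_tmul W hW γ _
  exact congrArg (fun T : M →L[ℂ] RTP α' γ => T v) this

theorem mapLeft_symm_ket₂ {W : H ≃ₗᵢ[ℂ] K} (hW : Intertwines W α α') (η : γ.space) (v : K) :
    (mapLeft W hW γ).symm (ket₂ α' γ η v) = ket₂ α γ η (W.symm v) := by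
  rw [LinearIsometryEquiv.symm_apply_eq, mapLeft_ket₂, LinearIsometryEquiv.apply_symm_apply]

theorem mapRight_ket₁ {γ : BaseModule Bd B M} {γ' : BaseModule Bd B L} {W : M ≃ₗᵢ[ℂ] L}
    (hW : Intertwines W γ γ') (ξ : α.space) (v : M) :
    mapRight α W hW (ket₁ α γ ξ v) = ket₁ α γ' ξ (W v) := by
  change flip γ' α (mapLeft W hW α (flip α γ (ket₁ α γ ξ v))) = _
  rw [flip_ket₁, mapLeft_ket₂]
  rfl

theorem mapRight_ket₂ {γ : BaseModule Bd B M} {γ' : BaseModule Bd B L} {W : M ≃ₗᵢ[ℂ] L}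
    (hW : Intertwines W γ γ') (η : γ.space) (v : H) :
    mapRight α W hW (ket₂ α γ η v) = ket₂ α γ' ⟨_, hW.mem η⟩ v := by
  change flip γ' α (mapLeft W hW α (flip α γ (ket₂ α γ η v))) = _
  rw [flip_ket₂, mapLeft_ket₁, flip_ket₁]

/-- On `|η⟩₂ v` both sides give `x ⊗ y* v ⊗ η`, since `⟨y|₁ |η⟩₂ = η y*`. It converts `α α* ⊗ 1`,
which regularity produces, into `|α⟩₁ ⟨α|₁`, which enters the leg `A`. -/
theorem ket₁_comp_adjoint_ket₁ (x y : α.space)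
    (h : (x : 𝔎 →L[ℂ] H) ∘L (y : 𝔎 →L[ℂ] H)† ∈ intertwiners α α) :
    ket₁ α γ x ∘L (ket₁ α γ y)† = tensorLeft γ α α ⟨_, h⟩ :=
  ext_ket₂ fun η v => by
    have h1 := congrArg (fun T : H →L[ℂ] M => T v) (adjoint_ket₁_ket₂ α γ y η)
    simp only [ContinuousLinearMap.comp_apply] at h1
    rw [tensorLeft_ket₂, ContinuousLinearMap.comp_apply, h1]
    exact (ket₁_apply α γ x η _).trans (ket₂_apply α γ η x _).symm

end TensorLeft

section Assoc

variable (β : BaseModule B Bd H) (γ : BaseModule Bd B K) (ε : BaseModule B₂ Bd₂ K)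
  (φ : BaseModule Bd₂ B₂ L) (h₁ : ActsOn γ ε) (h₂ : ActsOn ε γ)

theorem ket₁_comp_mem_rtri (ξ : β.space) (η : ε.space) :
    ket₁ β γ ξ ∘L (η : 𝔎 →L[ℂ] K) ∈ (rtri β γ ε h₁).space :=
  subset_cspan _ ⟨_, ⟨ξ, rfl⟩, η, η.2, rfl⟩

/-- This makes `|ξ⟩₁ ⊗ 1` available as a `tensorLeft`. -/
theorem ket₁_mem_intertwiners (ξ : β.space) :
    ket₁ β γ ξ ∈ intertwiners ε (rtri β γ ε h₁) :=
  fun c v => (rho_rtri β γ ε h₁ c ξ v).symm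

theorem ket₂_mem_intertwiners (η : φ.space) :
    ket₂ ε φ η ∈ intertwiners γ (ltri γ ε φ h₂) :=
  fun c v => (rho_ltri γ ε φ h₂ c η v).symm

/-- A ket on the first two legs jointly splits into two successive kets, so that `W₂₃` can be
evaluated with the first leg held fixed. -/
theorem assoc_ket₁ (ξ : β.space) (η : ε.space) (v : L) :
    assoc β γ ε φ h₁ h₂ (ket₁ (rtri β γ ε h₁) φ ⟨_, ket₁_comp_mem_rtri β γ ε h₁ ξ η⟩ v) =
      ket₁ β (ltri γ ε φ h₂) ξ (ket₁ ε φ η v) := by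
  have : (assoc β γ ε φ h₁ h₂ : _ →L[ℂ] _) ∘L
      ket₁ (rtri β γ ε h₁) φ ⟨_, ket₁_comp_mem_rtri β γ ε h₁ ξ η⟩ =
      ket₁ β (ltri γ ε φ h₂) ξ ∘L ket₁ ε φ η := φ.ext_vec fun η' hη' ζ => by
    have h1 := ket₁_apply (rtri β γ ε h₁) φ ⟨_, ket₁_comp_mem_rtri β γ ε h₁ ξ η⟩ ⟨η', hη'⟩ ζ
    have h2 := ket₂_apply (rtri β γ ε h₁) φ ⟨η', hη'⟩ ⟨_, ket₁_comp_mem_rtri β γ ε h₁ ξ η⟩ ζ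
    have h3 := ket₁_apply ε φ η ⟨η', hη'⟩ ζ
    have h4 := ket₂_apply ε φ ⟨η', hη'⟩ η ζ
    simp only [ContinuousLinearMap.comp_apply] at h1 h2 h3 h4 ⊢
    rw [h1, ← h2, h3, ← h4]
    exact assoc_apply β γ ε φ h₁ h₂ ξ _ _
  exact congrArg (fun T : L →L[ℂ] RTP β (ltri γ ε φ h₂) => T v) this

/-- On a threefold product, `|ξ⟩₁` is `|ξ⟩₁ ⊗ 1` up to associativity. This form lets it meet
operators acting on the first two legs. -/
theorem assoc_tensorLeft_ket₁ (φ : BaseModule Bd₂ B₂ L) (ξ : β.space) (v : RTP ε φ) :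
    assoc β γ ε φ h₁ h₂ (tensorLeft φ ε (rtri β γ ε h₁)
      ⟨_, ket₁_mem_intertwiners β γ ε h₁ ξ⟩ v) = ket₁ β (ltri γ ε φ h₂) ξ v := by
  have : (assoc β γ ε φ h₁ h₂ : _ →L[ℂ] _) ∘L tensorLeft φ ε (rtri β γ ε h₁)
      ⟨_, ket₁_mem_intertwiners β γ ε h₁ ξ⟩ = ket₁ β (ltri γ ε φ h₂) ξ :=
    ext_ket₂ fun η v => by
      rw [ContinuousLinearMap.comp_apply, tensorLeft_ket₂]
      exact assoc_apply β γ ε φ h₁ h₂ ξ v η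
  exact congrArg (fun T : RTP ε φ →L[ℂ] RTP β (ltri γ ε φ h₂) => T v) this

end Assoc

end RTP

open RTP

namespace RTP

theorem eq_of_inner_ket₂ {β : BaseModule B Bd H} {γ : BaseModule Bd B K} {x y : RTP β γ}
    (h : ∀ η v, ⟪ket₂ β γ η v, x⟫_ℂ = ⟪ket₂ β γ η v, y⟫_ℂ) : x = y := by
  refine (innerSL_inj (𝕜 := ℂ)).1 (ext_ket₂ fun η v => ?_)
  have := congrArg conj (h η v)
  rwa [inner_conj_symm, inner_conj_symm] at this

theorem adjoint_tensorLeft {α : BaseModule B Bd H} {α' : BaseModule B Bd K}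
    (γ : BaseModule Bd B L) (T : intertwiners α α') :
    (tensorLeft γ α α' T)† = tensorLeft γ α' α ⟨_, intertwiners_adjoint T.2⟩ :=
  ext_ket₂ fun η v => eq_of_inner_ket₂ fun η' w => by
    rw [ContinuousLinearMap.adjoint_inner_right, tensorLeft_ket₂, tensorLeft_ket₂, inner_ket₂,
      inner_ket₂, ← intertwiners_adjoint T.2, ContinuousLinearMap.adjoint_inner_right]

/-- Since `⟨ξ|₁ |ξ'⟩₁ = ρ_γ(ξ* ξ')` and `[β* β] = B`, the left side is `[ρ_γ(B) δ]`, which is `δ` by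
hypothesis. -/
theorem cspan_adjoint_ket₁_comp (β : BaseModule B Bd H) (γ : BaseModule Bd B K)
    {B' Bd' : NonUnitalStarSubalgebra ℂ (𝔎 →L[ℂ] 𝔎)} (δ : BaseModule B' Bd' K)
    (h : ActsOn γ δ) :
    cspan (opMul (opAdj (Set.range (ket₁ β γ)))
      (opMul (Set.range (ket₁ β γ)) (δ.space : Set (𝔎 →L[ℂ] K)))) = δ.space := by
  refine le_antisymm (cspan_le δ.isClosed ?_) ?_
  · rintro _ ⟨_, ⟨_, ⟨ξ, rfl⟩, rfl⟩, _, ⟨_, ⟨ξ', rfl⟩, η, hη, rfl⟩, rfl⟩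
    have := h.mem ⟨_, β.gram_mem ξ.2 ξ'.2⟩ hη
    rwa [← adjoint_ket₁_comp β γ ξ ξ'] at this
  · conv_lhs => rw [← h]
    refine cspan_le (isClosed_cspan _) ?_
    rintro _ ⟨c, η, hη, rfl⟩
    refine γ.rho_mem_of_span β.span_gram ((ContinuousLinearMap.compL ℂ 𝔎 K K).flip η)
      (isClosed_cspan _) ?_ c
    rintro ⟨_, hc⟩ ⟨ξ, hξ, ξ', hξ', rfl⟩
    refine subset_cspan (opMul (opAdj (Set.range (ket₁ β γ))) _)
      ⟨_, ⟨_, ⟨⟨ξ, hξ⟩, rfl⟩, rfl⟩, _, ⟨_, ⟨⟨ξ', hξ'⟩, rfl⟩, η, hη, rfl⟩, ?_⟩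
    have := adjoint_ket₁_comp β γ ⟨ξ, hξ⟩ ⟨ξ', hξ'⟩
    exact congrArg (fun T : K →L[ℂ] K => T ∘L η) this

end RTP

theorem Intertwines.opMul_eq {B' Bd' : NonUnitalStarSubalgebra ℂ (𝔎 →L[ℂ] 𝔎)} {W : H ≃ₗᵢ[ℂ] K}
    {α : BaseModule B Bd H} {γ : BaseModule B' Bd' K} (h : Intertwines W α γ) :
    opMul {(W : H →L[ℂ] K)} (α.space : Set (𝔎 →L[ℂ] H)) = γ.space :=
  Set.image2_singleton_left.trans h

theorem Intertwines.opMul_symm_eq {B' Bd' : NonUnitalStarSubalgebra ℂ (𝔎 →L[ℂ] 𝔎)}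
    {W : H ≃ₗᵢ[ℂ] K} {α : BaseModule B Bd H} {γ : BaseModule B' Bd' K} (h : Intertwines W α γ) :
    opMul {(W.symm : K →L[ℂ] H)} (γ.space : Set (𝔎 →L[ℂ] K)) = α.space := by
  rw [← h.opMul_eq, ← opMul_assoc]
  have : opMul {(W.symm : K →L[ℂ] H)} {(W : H →L[ℂ] K)} = {ContinuousLinearMap.id ℂ H} := by
    refine Set.image2_singleton.trans (congrArg _ ?_)
    ext v
    exact W.symm_apply_apply v
  rw [this]
  exact Set.image2_singleton_left.trans (Set.image_id _)

/-- From `ρ_α(c*) y = y c*` the adjoint gives `y* ρ_α(c) = c y*`, while `x c = ρ_α(c) x`. -/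
theorem BaseModule.comp_adjoint_mem_intertwiners (α : BaseModule B Bd H) {x y : 𝔎 →L[ℂ] H}
    (hx : x ∈ α.space) (hy : y ∈ α.space) : x ∘L (y)† ∈ intertwiners α α := by
  intro c v
  have h1 : (y)† ∘L α.rho c = (c : 𝔎 →L[ℂ] 𝔎) ∘L (y)† := by
    have h2 : α.rho (star c) ∘L y = y ∘L ((c : 𝔎 →L[ℂ] 𝔎))† := by
      ext ζ
      exact α.rho_apply _ hy ζ
    have h3 := congrArg (fun T => (T)†) h2
    simp only [ContinuousLinearMap.adjoint_comp, α.adjoint_rho, star_star,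
      ContinuousLinearMap.adjoint_adjoint] at h3
    exact h3
  have h4 := congrArg (fun T : H →L[ℂ] 𝔎 => x (T v)) h1
  simp only [ContinuousLinearMap.comp_apply] at h4 ⊢
  rw [h4, α.rho_apply c hx]

/-! ### Regular pseudo-multiplicative unitaries -/

section PMU

variable {βh : BaseModule Bd B H} {α : BaseModule B Bd H} {β : BaseModule Bd B H}

theorem legA_eq (W : RTP βh α ≃ₗᵢ[ℂ] RTP α β) :
    legA W = cspan (opMul (opAdj (Set.range (ket₁ α β)))
      (opMul {(W : RTP βh α →L[ℂ] RTP α β)} (Set.range (ket₁ βh α)))) := by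
  refine congrArg cspan (Set.ext fun a => ⟨?_, ?_⟩)
  · rintro ⟨ξ, η, rfl⟩
    exact ⟨_, ⟨_, ⟨ξ, rfl⟩, rfl⟩, _, ⟨_, rfl, _, ⟨η, rfl⟩, rfl⟩, rfl⟩
  · rintro ⟨_, ⟨_, ⟨ξ, rfl⟩, rfl⟩, _, ⟨_, rfl, _, ⟨η, rfl⟩, rfl⟩, rfl⟩
    exact ⟨ξ, η, rfl⟩

theorem BaseModule.compacts_eq (α : BaseModule B Bd H) :
    α.compacts = cspan (opMul (α.space : Set (𝔎 →L[ℂ] H)) (opAdj α.space)) := by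
  refine congrArg cspan (Set.ext fun a => ⟨?_, ?_⟩)
  · rintro ⟨ξ, hξ, ξ', hξ', rfl⟩
    exact ⟨ξ, hξ, _, ⟨ξ', hξ', rfl⟩, rfl⟩
  · rintro ⟨ξ, hξ, _, ⟨ξ', hξ', rfl⟩, rfl⟩
    exact ⟨ξ, hξ, ξ', hξ', rfl⟩

/-- The set `⟨α|₁ W |α⟩₂`, whose closed span is `[α α*]` if `W` is regular. -/
def regularSet (W : RTP βh α ≃ₗᵢ[ℂ] RTP α β) : Set (H →L[ℂ] H) :=
  {a | ∃ ξ ξ' : α.space,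
    (ket₁ α β ξ)† ∘L (W : RTP βh α →L[ℂ] RTP α β) ∘L ket₂ βh α ξ' = a}

/-- The set `α α*` is stable under adjoints, so regularity equally describes the operators `⟨α|₂ W*
|α⟩₁`, the form in which it meets the pentagon equation. -/
theorem IsRegular.cspan_opAdj {W : RTP βh α ≃ₗᵢ[ℂ] RTP α β} (h : IsRegular W) :
    cspan (opAdj (regularSet W)) =
      cspan (opMul (α.space : Set (𝔎 →L[ℂ] H)) (opAdj α.space)) := by
  have h1 : cspan (regularSet W) = cspan (opMul (α.space : Set (𝔎 →L[ℂ] H)) (opAdj α.space)) :=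
    Eq.trans h α.compacts_eq
  rw [cspan_opAdj_congr h1, opAdj_opMul, opAdj_opAdj]

theorem adjoint_regular (W : RTP βh α ≃ₗᵢ[ℂ] RTP α β) (ξ ξ' : α.space) :
    ((ket₁ α β ξ)† ∘L (W : RTP βh α →L[ℂ] RTP α β) ∘L ket₂ βh α ξ')† =
      (ket₂ βh α ξ')† ∘L (W.symm : RTP α β →L[ℂ] RTP βh α) ∘L ket₁ α β ξ := by
  rw [ContinuousLinearMap.adjoint_comp, ContinuousLinearMap.adjoint_comp, adjoint_eq_symm,
    ContinuousLinearMap.adjoint_adjoint, ContinuousLinearMap.comp_assoc]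

/-! ### Slices of the pentagon equation and the absorption rule -/

namespace IsPMU

variable {hm : IsTriModule βh α β} {W : RTP βh α ≃ₗᵢ[ℂ] RTP α β}

/-- `[A* βh] = βh`. -/
theorem cspan_adjoint_legA_comp (h : IsPMU hm W) :
    cspan (opMul (opAdj (legA W : Set (H →L[ℂ] H))) (βh.space : Set (𝔎 →L[ℂ] H))) =
      βh.space := by
  have hA : cspan (legA W : Set (H →L[ℂ] H)) = cspan (opMul (opAdj (Set.range (ket₁ α β)))
      (opMul {(W : RTP βh α →L[ℂ] RTP α β)} (Set.range (ket₁ βh α)))) :=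
    (cspan_coe (isClosed_cspan _)).trans (legA_eq W)
  have hW : opAdj {(W : RTP βh α →L[ℂ] RTP α β)} = {(W.symm : RTP α β →L[ℂ] RTP βh α)} :=
    Set.image_singleton.trans (congrArg _ (adjoint_eq_symm W))
  have h1 : (rtri α β βh hm.β_βh).space = cspan (opMul (Set.range (ket₁ α β)) βh.space) := rfl
  have h2 : (rtri βh α βh hm.α_βh).space = cspan (opMul (Set.range (ket₁ βh α)) βh.space) := rfl
  have h3 := h.map_βh_βh.opMul_symm_eq
  -- This is `W* (α ▷ β̂) = β̂ ▷ β̂` written with kets. It reduces `[A* β̂] = [⟨β̂|₁ W* |α⟩₁ β̂]` to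
  -- `[⟨β̂|₁ |β̂⟩₁ β̂] = β̂`.
  have h4 : cspan (opMul {(W.symm : RTP α β →L[ℂ] RTP βh α)}
      (opMul (Set.range (ket₁ α β)) (βh.space : Set (𝔎 →L[ℂ] H)))) =
      cspan (opMul (Set.range (ket₁ βh α)) (βh.space : Set (𝔎 →L[ℂ] H))) := by
    rw [← cspan_opMul_right, ← h1, h3, h2, cspan_coe (isClosed_cspan _)]
  rw [cspan_opMul_congr_left (cspan_opAdj_congr hA), opAdj_opMul, opAdj_opMul, opAdj_opAdj, hW,
    opMul_assoc, opMul_assoc, cspan_opMul_congr_right _ h4, cspan_adjoint_ket₁_comp βh α βh hm.α_βh]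

/-- Each of the three factors intertwines the representations attached to `α`, `α ◁ α` and `α ▷ α`.
Hence the operator can be amplified to `⟨ξ'|₂ W* |ξ⟩₁ ⊗ 1`. -/
theorem adjoint_regular_mem (h : IsPMU hm W) (ξ ξ' : α.space) :
    ((ket₁ α β ξ)† ∘L (W : RTP βh α →L[ℂ] RTP α β) ∘L ket₂ βh α ξ')† ∈ intertwiners α α :=
  intertwiners_adjoint <| intertwiners_comp
    (intertwiners_adjoint (ket₁_mem_intertwiners α β α hm.β_α ξ))
    (intertwiners_comp h.map_α_α.mem_intertwiners (ket₂_mem_intertwiners α βh α hm.βh_α ξ'))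

/-- The bra operator `⟨ξ|₂ ⊗ 1` from `(H_βh ⊗ {}_α H)_{α ◁ α} ⊗ {}_β H` to `H_α ⊗ {}_β H`. -/
def braTwo (hm : IsTriModule βh α β) (ξ : α.space) :
    RTP (ltri α βh α hm.βh_α) β →L[ℂ] RTP α β :=
  (tensorLeft β α (ltri α βh α hm.βh_α) ⟨_, ket₂_mem_intertwiners α βh α hm.βh_α ξ⟩)†

theorem braTwo_ket₂ (ξ : α.space) (η : β.space) (v : RTP βh α) :
    braTwo hm ξ (ket₂ (ltri α βh α hm.βh_α) β η v) = ket₂ α β η (((ket₂ βh α ξ)†) v) := by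
  rw [braTwo, adjoint_tensorLeft, tensorLeft_ket₂]

/-- `ω ↦ (⟨ξ|₂ ⊗ 1) W₁₂* W₂₃ |ω⟩₁`. -/
def sliceLeft (h : IsPMU hm W) (ξ : α.space) :
    (rtri α β βh hm.β_βh).space →L[ℂ] (H →L[ℂ] RTP α β) :=
  ContinuousLinearMap.compL ℂ H _ _ (braTwo hm ξ ∘L
    ((mapLeft W h.map_α_α β).symm :
      RTP (rtri α β α hm.β_α) β →L[ℂ] RTP (ltri α βh α hm.βh_α) β) ∘L
    ((assoc α β α β hm.β_α hm.α_β).symm :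
      RTP α (ltri β α β hm.α_β) →L[ℂ] RTP (rtri α β α hm.β_α) β) ∘L
    (mapRight α W h.map_β_α :
      RTP α (ltri β βh α hm.βh_β) →L[ℂ] RTP α (ltri β α β hm.α_β)) ∘L
    (assoc α β βh α hm.β_βh hm.βh_β :
      RTP (rtri α β βh hm.β_βh) α →L[ℂ] RTP α (ltri β βh α hm.βh_β))) ∘L ket₁L (rtri α β βh hm.β_βh) α

/-- `ω ↦ (⟨ξ|₂ ⊗ 1) W₁₃ W₂₃ |ω⟩₁`. -/
def sliceRight (h : IsPMU hm W) (ξ : α.space) :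
    (rtri βh α βh hm.α_βh).space →L[ℂ] (H →L[ℂ] RTP α β) :=
  ContinuousLinearMap.compL ℂ H _ _ (braTwo hm ξ ∘L
    (leg₁₃ hm W h.map_βh_β :
      RTP βh (rtri α β α hm.β_α) →L[ℂ] RTP (ltri α βh α hm.βh_α) β) ∘L
    (mapRight βh W h.map_α_α :
      RTP βh (ltri α βh α hm.βh_α) →L[ℂ] RTP βh (rtri α β α hm.β_α)) ∘L
    (assoc βh α βh α hm.α_βh hm.βh_α :
      RTP (rtri βh α βh hm.α_βh) α →L[ℂ] RTP βh (ltri α βh α hm.βh_α))) ∘L ket₁L (rtri βh α βh hm.α_βh) α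

/-- The pentagon equation in the form `W₁₂* W₂₃ W₁₂ = W₁₃ W₂₃`. -/
theorem sliceLeft_map (h : IsPMU hm W) (ξ : α.space) (ω : (rtri βh α βh hm.α_βh).space) :
    sliceLeft h ξ ⟨_, h.map_βh_βh.mem ω⟩ = sliceRight h ξ ω := by
  refine ContinuousLinearMap.ext fun v => ?_
  have h1 := h.pentagon (ket₁ (rtri βh α βh hm.α_βh) α ω v)
  -- Here `W₁₂ |ω⟩₁ = |W ω⟩₁`; the outer `W₁₂` of the pentagon then cancels against the inverse
  -- built into `sliceLeft`.
  rw [mapLeft_ket₁] at h1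
  change braTwo hm ξ ((mapLeft W h.map_α_α β).symm ((assoc α β α β hm.β_α hm.α_β).symm
    (mapRight α W h.map_β_α (assoc α β βh α hm.β_βh hm.βh_β
      (ket₁ (rtri α β βh hm.β_βh) α ⟨_, h.map_βh_βh.mem ω⟩ v))))) = _
  rw [h1, LinearIsometryEquiv.symm_apply_apply, LinearIsometryEquiv.symm_apply_apply]
  rfl

/-- `W₂₃` does not touch the first leg, so `W₂₃ |ξ⟩₁ |η⟩₁ = |ξ⟩₁ W |η⟩₁`. The remaining `⟨ξ'|₂ W₁₂*
|ξ⟩₁` acts only on the first factor of what follows and is the amplification of `⟨ξ'|₂ W* |ξ⟩₁`. -/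
theorem sliceLeft_ket₁ (h : IsPMU hm W) (ξ ξ' : α.space) (η : βh.space) :
    sliceLeft h ξ' ⟨_, ket₁_comp_mem_rtri α β βh hm.β_βh ξ η⟩ =
      tensorLeft β α α ⟨_, h.adjoint_regular_mem ξ ξ'⟩ ∘L
        (W : RTP βh α →L[ℂ] RTP α β) ∘L ket₁ βh α η := by
  have key : braTwo hm ξ' ∘L ((mapLeft W h.map_α_α β).symm :
      RTP (rtri α β α hm.β_α) β →L[ℂ] RTP (ltri α βh α hm.βh_α) β) ∘L
      tensorLeft β α (rtri α β α hm.β_α) ⟨_, ket₁_mem_intertwiners α β α hm.β_α ξ⟩ =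
      tensorLeft β α α ⟨_, h.adjoint_regular_mem ξ ξ'⟩ := ext_ket₂ fun η' v => by
    rw [tensorLeft_ket₂, ContinuousLinearMap.comp_apply, ContinuousLinearMap.comp_apply,
      tensorLeft_ket₂]
    change braTwo hm ξ' ((mapLeft W h.map_α_α β).symm (ket₂ (rtri α β α hm.β_α) β η' _)) = _
    rw [mapLeft_symm_ket₂, braTwo_ket₂]
    simp only [adjoint_regular]
    rfl
  refine ContinuousLinearMap.ext fun v => ?_
  change braTwo hm ξ' ((mapLeft W h.map_α_α β).symm ((assoc α β α β hm.β_α hm.α_β).symm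
    (mapRight α W h.map_β_α (assoc α β βh α hm.β_βh hm.βh_β
      (ket₁ (rtri α β βh hm.β_βh) α ⟨_, ket₁_comp_mem_rtri α β βh hm.β_βh ξ η⟩ v))))) = _
  rw [assoc_ket₁, mapRight_ket₁, ← assoc_tensorLeft_ket₁ α β α hm.β_α hm.α_β β,
    LinearIsometryEquiv.symm_apply_apply]
  exact congrArg (fun T : RTP α β →L[ℂ] RTP α β => T (W (ket₁ βh α η v))) key

/-- `W₁₃` leaves the second leg alone: `ξ` is carried along while `W` acts on `|η⟩₁ v`, and is
reinserted in the second slot. -/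
theorem leg₁₃_ket₁ (h : IsPMU hm W) (η : βh.space) (ξ : α.space) (v : H) :
    leg₁₃ hm W h.map_βh_β (ket₁ βh (rtri α β α hm.β_α) η (ket₁ α β ξ v)) =
      tensorLeft β α (ltri α βh α hm.βh_α) ⟨_, ket₂_mem_intertwiners α βh α hm.βh_α ξ⟩
        (W (ket₁ βh α η v)) := by
  have key : (RTP.flip β (ltri α βh α hm.βh_α) :
      RTP β (ltri α βh α hm.βh_α) →L[ℂ] RTP (ltri α βh α hm.βh_α) β) ∘L
      (assoc β α βh α hm.α_βh hm.βh_α :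
      RTP (rtri β α βh hm.α_βh) α →L[ℂ] RTP β (ltri α βh α hm.βh_α)) ∘L
      ket₂ (rtri β α βh hm.α_βh) α ξ ∘L (RTP.flip α β : RTP α β →L[ℂ] RTP β α) =
      tensorLeft β α (ltri α βh α hm.βh_α) ⟨_, ket₂_mem_intertwiners α βh α hm.βh_α ξ⟩ :=
    ext_ket₂ fun η' w => by
      rw [tensorLeft_ket₂]
      change RTP.flip β (ltri α βh α hm.βh_α) (assoc β α βh α hm.α_βh hm.βh_α
        (ket₂ (rtri β α βh hm.α_βh) α ξ (RTP.flip α β (ket₂ α β η' w)))) = _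
      rw [flip_ket₂, assoc_apply, flip_ket₁]
  have h1 : (assoc βh α β α hm.α_β hm.β_α).symm
      (ket₁ βh (ltri α β α hm.β_α) η (ket₂ β α ξ v)) =
      ket₂ (rtri βh α β hm.α_β) α ξ (ket₁ βh α η v) := by
    rw [LinearIsometryEquiv.symm_apply_eq, assoc_apply]
  simp only [leg₁₃, LinearIsometryEquiv.trans_apply]
  rw [mapRight_ket₁, flip_ket₁, h1, mapLeft_ket₂, mapLeft_ket₂, ← key]
  rfl

/-- Test on `|x⟩₁ v` after `W₂₃`. With `b = ξ* x`, the bra and ket in the second leg combine to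
`ρ(b)` for `β̂ ◁ β`. Because `W (β̂ ▷ β) = β̂ ◁ β`, this moves to the right through `W` and `|η⟩₁`
and becomes `ρ_β(b) = ⟨ξ|₁ |x⟩₁`. -/
theorem sliceRight_ket₁ (h : IsPMU hm W) (ξ : α.space) (η η' : βh.space) :
    sliceRight h ξ ⟨_, ket₁_comp_mem_rtri βh α βh hm.α_βh η η'⟩ =
      (W : RTP βh α →L[ℂ] RTP α β) ∘L ket₁ βh α η ∘L (ket₁ α β ξ)† ∘L
        (W : RTP βh α →L[ℂ] RTP α β) ∘L ket₁ βh α η' := by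
  have key : braTwo hm ξ ∘L (leg₁₃ hm W h.map_βh_β :
      RTP βh (rtri α β α hm.β_α) →L[ℂ] RTP (ltri α βh α hm.βh_α) β) ∘L
      ket₁ βh (rtri α β α hm.β_α) η =
      (W : RTP βh α →L[ℂ] RTP α β) ∘L ket₁ βh α η ∘L (ket₁ α β ξ)† := ext_ket₁ fun x v => by
    let b : B := ⟨_, α.gram_mem ξ.2 x.2⟩
    have h1 : ∀ w, braTwo hm ξ (tensorLeft β α (ltri α βh α hm.βh_α)
        ⟨_, ket₂_mem_intertwiners α βh α hm.βh_α x⟩ w) =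
        (ltri βh α β hm.α_βh).rho b w := by
      have : braTwo hm ξ ∘L tensorLeft β α (ltri α βh α hm.βh_α)
        ⟨_, ket₂_mem_intertwiners α βh α hm.βh_α x⟩ = (ltri βh α β hm.α_βh).rho b :=
        ext_ket₂ fun η' w => by
          rw [ContinuousLinearMap.comp_apply, tensorLeft_ket₂, braTwo_ket₂, rho_ltri]
          exact congrArg (fun T : H →L[ℂ] H => ket₂ α β η' (T w)) (adjoint_ket₂_comp βh α ξ x)
      exact fun w => congrArg (fun T : RTP α β →L[ℂ] RTP α β => T w) this
    have h2 : ((ket₁ α β ξ)†) (ket₁ α β x v) = β.rho b v :=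
      congrArg (fun T : H →L[ℂ] H => T v) (adjoint_ket₁_comp α β ξ x)
    change braTwo hm ξ (leg₁₃ hm W h.map_βh_β
      (ket₁ βh (rtri α β α hm.β_α) η (ket₁ α β x v))) =
      W (ket₁ βh α η (((ket₁ α β ξ)†) (ket₁ α β x v)))
    rw [leg₁₃_ket₁ h, h1, h2, ← h.map_βh_β.rho_apply, rho_rtri]
  refine ContinuousLinearMap.ext fun v => ?_
  change braTwo hm ξ (leg₁₃ hm W h.map_βh_β (mapRight βh W h.map_α_α
    (assoc βh α βh α hm.α_βh hm.βh_α
      (ket₁ (rtri βh α βh hm.α_βh) α ⟨_, ket₁_comp_mem_rtri βh α βh hm.α_βh η η'⟩ v)))) = _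
  rw [assoc_ket₁, mapRight_ket₁]
  exact congrArg (fun T : RTP α β →L[ℂ] RTP α β => T (W (ket₁ βh α η' v))) key

/-- `T ↦ (T ⊗ 1) W |η⟩₁`. -/
def sliceTensor (W : RTP βh α ≃ₗᵢ[ℂ] RTP α β) (η : βh.space) :
    intertwiners α α →L[ℂ] (H →L[ℂ] RTP α β) :=
  (ContinuousLinearMap.compL ℂ H (RTP α β) (RTP α β)).flip
    ((W : RTP βh α →L[ℂ] RTP α β) ∘L ket₁ βh α η) ∘L tensorLeft β α α

theorem sliceTensor_comp_adjoint (W : RTP βh α ≃ₗᵢ[ℂ] RTP α β) (x y : α.space) (η : βh.space) :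
    sliceTensor W η ⟨_, α.comp_adjoint_mem_intertwiners x.2 y.2⟩ =
      ket₁ α β x ∘L (ket₁ α β y)† ∘L (W : RTP βh α →L[ℂ] RTP α β) ∘L ket₁ βh α η := by
  change tensorLeft β α α _ ∘L (W : RTP βh α →L[ℂ] RTP α β) ∘L ket₁ βh α η = _
  rw [← ket₁_comp_adjoint_ket₁, ContinuousLinearMap.comp_assoc]

/-- The common values of the two slices are compared with each side of the absorption rule through
an arbitrary closed subspace `C`, to be taken as one of the two spans. Here `β̂ ▷ β̂` is generated
by the elements `|η⟩₁ η'`. -/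
theorem sliceRight_mem_of_forall (h : IsPMU hm W) {C : Submodule ℂ (H →L[ℂ] RTP α β)}
    (hC : IsClosed (C : Set (H →L[ℂ] RTP α β)))
    (hx : ∀ (η η' : βh.space) (ξ : α.space), (W : RTP βh α →L[ℂ] RTP α β) ∘L ket₁ βh α η ∘L
      (ket₁ α β ξ)† ∘L (W : RTP βh α →L[ℂ] RTP α β) ∘L ket₁ βh α η' ∈ C)
    (ξ : α.space) (ω : (rtri βh α βh hm.α_βh).space) : sliceRight h ξ ω ∈ C := by
  refine map_mem_of_mem_cspan (sliceRight h ξ) (S := opMul (Set.range (ket₁ βh α)) βh.space)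
    (subset_cspan _) hC ?_ ω ω.2
  rintro _ ⟨_, ⟨η₁, rfl⟩, η₂, hη₂, rfl⟩
  rw [sliceRight_ket₁ h ξ η₁ ⟨η₂, hη₂⟩]
  exact hx η₁ ⟨η₂, hη₂⟩ ξ

/-- The slice is rewritten as a left slice at `W ω ∈ α ▷ β̂`. On generators it is an amplified `⟨α|₂
W* |α⟩₁`, which regularity approximates by sums of `x y* ⊗ 1 = |x⟩₁ ⟨y|₁`. -/
theorem sliceRight_mem_of_regular (h : IsPMU hm W) {C : Submodule ℂ (H →L[ℂ] RTP α β)}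
    (hC : IsClosed (C : Set (H →L[ℂ] RTP α β))) (hr : IsRegular W)
    (hx : ∀ (x y : α.space) (η : βh.space), ket₁ α β x ∘L (ket₁ α β y)† ∘L
      (W : RTP βh α →L[ℂ] RTP α β) ∘L ket₁ βh α η ∈ C)
    (ξ : α.space) (ω : (rtri βh α βh hm.α_βh).space) : sliceRight h ξ ω ∈ C := by
  have hK : opMul (α.space : Set (𝔎 →L[ℂ] H)) (opAdj α.space) ⊆
      (intertwiners α α : Set (H →L[ℂ] H)) := by
    rintro _ ⟨x, hx, _, ⟨y, hy, rfl⟩, rfl⟩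
    exact α.comp_adjoint_mem_intertwiners hx hy
  rw [← sliceLeft_map]
  refine map_mem_of_mem_cspan (sliceLeft h ξ) (S := opMul (Set.range (ket₁ α β)) βh.space)
    (subset_cspan _) hC ?_ _ (h.map_βh_βh.mem ω)
  rintro _ ⟨_, ⟨ξ', rfl⟩, η, hη, rfl⟩
  rw [sliceLeft_ket₁ h ξ' ξ ⟨η, hη⟩]
  have hmem : ((ket₁ α β ξ')† ∘L (W : RTP βh α →L[ℂ] RTP α β) ∘L ket₂ βh α ξ)† ∈
      cspan (opMul (α.space : Set (𝔎 →L[ℂ] H)) (opAdj α.space)) := by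
    rw [← hr.cspan_opAdj]
    exact subset_cspan (opAdj (regularSet W)) ⟨_, ⟨ξ', ξ, rfl⟩, rfl⟩
  -- Amplification is defined and bounded on intertwiners only, so the approximation takes place
  -- inside that subspace.
  refine map_mem_of_mem_cspan (sliceTensor W ⟨η, hη⟩) hK hC ?_
    ⟨_, adjoint_regular_mem h ξ' ξ⟩ hmem
  rintro _ ⟨x, hx', _, ⟨y, hy, rfl⟩, rfl⟩
  exact (sliceTensor_comp_adjoint W ⟨x, hx'⟩ ⟨y, hy⟩ ⟨η, hη⟩).symm ▸ hx ⟨x, hx'⟩ ⟨y, hy⟩ ⟨η, hη⟩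

/-- Regularity in the opposite direction: `x y*` is approximated by sums of operators `⟨α|₂ W*
|α⟩₁`, whose amplifications are slices. -/
theorem comp_adjoint_mem_of_sliceRight (h : IsPMU hm W) {C : Submodule ℂ (H →L[ℂ] RTP α β)}
    (hC : IsClosed (C : Set (H →L[ℂ] RTP α β))) (hr : IsRegular W)
    (hx : ∀ ξ ω, sliceRight h ξ ω ∈ C) (x y : α.space) (η : βh.space) :
    ket₁ α β x ∘L (ket₁ α β y)† ∘L (W : RTP βh α →L[ℂ] RTP α β) ∘L ket₁ βh α η ∈ C := by
  have hS : opAdj (regularSet W) ⊆ (intertwiners α α : Set (H →L[ℂ] H)) := by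
    rintro _ ⟨_, ⟨ξ, ξ', rfl⟩, rfl⟩
    exact adjoint_regular_mem h ξ ξ'
  have hmem : (x : 𝔎 →L[ℂ] H) ∘L (y : 𝔎 →L[ℂ] H)† ∈ cspan (opAdj (regularSet W)) := by
    rw [hr.cspan_opAdj]
    exact subset_cspan _ (Set.mem_image2_of_mem x.2 (Set.mem_image_of_mem _ y.2))
  rw [← sliceTensor_comp_adjoint]
  refine map_mem_of_mem_cspan (sliceTensor W η) hS hC ?_ _ hmem
  rintro _ ⟨_, ⟨ξ, ξ', rfl⟩, rfl⟩
  -- The right slice is evaluated at `ω = W* (|ξ⟩₁ η)`, which lies in `β̂ ▷ β̂`, so that the left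
  -- slice is taken at exactly `|ξ⟩₁ η`.
  have hω := h.map_βh_βh.symm_mem (ket₁_comp_mem_rtri α β βh hm.β_βh ξ η)
  have e := sliceLeft_map h ξ' ⟨_, hω⟩
  have e' : (W : RTP βh α →L[ℂ] RTP α β) ∘L ((W.symm : RTP α β →L[ℂ] RTP βh α) ∘L
      (ket₁ α β ξ ∘L (η : 𝔎 →L[ℂ] H))) = ket₁ α β ξ ∘L (η : 𝔎 →L[ℂ] H) := by
    ext ζ
    exact W.apply_symm_apply _
  simp only [e'] at e
  rw [sliceLeft_ket₁ h ξ ξ' η] at e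
  have hmem' := hx ξ' ⟨_, hω⟩
  rw [← e] at hmem'
  exact hmem'

/-- For a regular `C*`-pseudo-multiplicative unitary `W`, `[|α⟩₁ A] = [W |βh⟩₁ A]`. -/
theorem cspan_ket₁_legA (h : IsPMU hm W) (hr : IsRegular W) :
    cspan (opMul (Set.range (ket₁ α β)) (legA W : Set (H →L[ℂ] H))) =
      cspan (opMul {(W : RTP βh α →L[ℂ] RTP α β)}
        (opMul (Set.range (ket₁ βh α)) (legA W : Set (H →L[ℂ] H)))) := by
  -- After expanding `A`, the two sides are generated by `|x⟩₁ ⟨y|₁ W |η⟩₁` and by `W |η₁⟩₁ ⟨ξ'|₁ W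
  -- |η₂⟩₁`, the generators occurring in the slices.
  rw [legA_eq, ← opMul_assoc {_}, cspan_opMul_right, cspan_opMul_right, opMul_assoc {_}]
  refine le_antisymm (cspan_le (isClosed_cspan _) ?_) (cspan_le (isClosed_cspan _) ?_)
  · rintro _ ⟨_, ⟨x, rfl⟩, _, ⟨_, ⟨_, ⟨y, rfl⟩, rfl⟩, _, ⟨_, rfl, _, ⟨η, rfl⟩, rfl⟩, rfl⟩, rfl⟩
    refine comp_adjoint_mem_of_sliceRight h (isClosed_cspan _) hr
      (sliceRight_mem_of_forall h (isClosed_cspan _) fun η η' ξ => ?_) x y η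
    exact subset_cspan _ ⟨_, rfl, _, ⟨_, ⟨η, rfl⟩, _, ⟨_, ⟨_, ⟨ξ, rfl⟩, rfl⟩, _, ⟨_, rfl, _,
      ⟨η', rfl⟩, rfl⟩, rfl⟩, rfl⟩, rfl⟩
  · rintro _ ⟨_, rfl, _, ⟨_, ⟨η₁, rfl⟩, _, ⟨_, ⟨_, ⟨ξ', rfl⟩, rfl⟩, _, ⟨_, rfl, _,
        ⟨η₂, rfl⟩, rfl⟩, rfl⟩, rfl⟩, rfl⟩
    have := sliceRight_mem_of_regular h (isClosed_cspan _) hr (fun x y η => subset_cspan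
      (opMul (Set.range (ket₁ α β)) (opMul (opAdj (Set.range (ket₁ α β)))
        (opMul {(W : RTP βh α →L[ℂ] RTP α β)} (Set.range (ket₁ βh α)))))
      ⟨_, ⟨x, rfl⟩, _, ⟨_, ⟨_, ⟨y, rfl⟩, rfl⟩, _, ⟨_, rfl, _, ⟨η, rfl⟩, rfl⟩, rfl⟩, rfl⟩)
      ξ' ⟨_, ket₁_comp_mem_rtri βh α βh hm.α_βh η₁ η₂⟩
    rwa [sliceRight_ket₁ h] at this

end IsPMU

end PMU

/-! ### Pseudo-Kac systems -/

section Kac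

variable {αh : BaseModule B Bd H} {βh : BaseModule Bd B H} {α : BaseModule B Bd H}
  {β : BaseModule Bd B H} {U : H ≃ₗᵢ[ℂ] H}

namespace IsSymmetry

theorem symm_eq (hU : IsSymmetry αh βh α β U) (v : H) : U.symm v = U v := by
  rw [LinearIsometryEquiv.symm_apply_eq, hU.involutive]

theorem adjoint_eq (hU : IsSymmetry αh βh α β U) : ((U : H →L[ℂ] H))† = (U : H →L[ℂ] H) := by
  rw [adjoint_eq_symm]
  ext v
  exact hU.symm_eq v

theorem comp_comp (hU : IsSymmetry αh βh α β U) (ξ : 𝔎 →L[ℂ] H) :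
    (U : H →L[ℂ] H) ∘L ((U : H →L[ℂ] H) ∘L ξ) = ξ := by
  ext v
  exact hU.involutive _

/-- The inner `(1 ⊗ U) Σ` of `V̌` turns `|ξ⟩₁` into `|Uξ⟩₂`, and what is left is `Σ (1 ⊗ U) V`, the
operator in the cube relation. -/
theorem checkV_ket₁ (hU : IsSymmetry αh βh α β U) (V : RTP βh α ≃ₗᵢ[ℂ] RTP α β)
    (ξ : αh.space) (v : H) :
    checkV hU V (ket₁ αh βh ξ v) = kacOp hU V (ket₂ βh α ⟨_, hU.αh_α.mem ξ⟩ v) := by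
  simp only [checkV, kacOp, LinearIsometryEquiv.trans_apply]
  rw [flip_ket₁, mapRight_ket₂]

/-- The outer `Σ (1 ⊗ U)` carries `|η⟩₂` to `|Uη⟩₁`, so `⟨Uη|₁ V̌ |Uξ⟩₁ = ⟨η|₂ V |ξ⟩₂`. As `U`
exchanges `α` with `α̂` and `β` with `β̂`, the generating sets of both legs coincide. -/
theorem legAhat_eq (hU : IsSymmetry αh βh α β U) (V : RTP βh α ≃ₗᵢ[ℂ] RTP α β) :
    legAhat V = legA (checkV hU V) := by
  have key : ∀ (η : β.space) (ξ : α.space),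
      (ket₁ βh α ⟨_, hU.β_βh.mem η⟩)† ∘L
        (checkV hU V : RTP αh βh →L[ℂ] RTP βh α) ∘L ket₁ αh βh ⟨_, hU.α_αh.mem ξ⟩ =
      (ket₂ α β η)† ∘L (V : RTP βh α →L[ℂ] RTP α β) ∘L ket₂ βh α ξ := by
    intro η ξ
    refine ContinuousLinearMap.ext fun v => ext_inner_left ℂ fun w => ?_
    change ⟪w, ((ket₁ βh α ⟨_, hU.β_βh.mem η⟩)†)
      (checkV hU V (ket₁ αh βh ⟨_, hU.α_αh.mem ξ⟩ v))⟫_ℂ =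
      ⟪w, ((ket₂ α β η)†) (V (ket₂ βh α ξ v))⟫_ℂ
    have e : (⟨_, hU.αh_α.mem ⟨_, hU.α_αh.mem ξ⟩⟩ : α.space) = ξ := Subtype.ext (hU.comp_comp _)
    rw [ContinuousLinearMap.adjoint_inner_right, ContinuousLinearMap.adjoint_inner_right,
      checkV_ket₁, e]
    have e2 : ket₁ βh α ⟨_, hU.β_βh.mem η⟩ w = flip α βh (mapRight α U hU.β_βh (ket₂ α β η w)) := by
      rw [mapRight_ket₂, flip_ket₂]
    rw [e2]
    simp only [kacOp, LinearIsometryEquiv.trans_apply, LinearIsometryEquiv.inner_map_map]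
  refine congrArg cspan (Set.ext fun a => ⟨?_, ?_⟩)
  · rintro ⟨η, ξ, rfl⟩
    exact ⟨_, _, key η ξ⟩
  · rintro ⟨η, ξ, rfl⟩
    refine ⟨⟨_, hU.βh_β.mem η⟩, ⟨_, hU.αh_α.mem ξ⟩, ?_⟩
    rw [← key]
    have e : (⟨_, hU.β_βh.mem ⟨_, hU.βh_β.mem η⟩⟩ : βh.space) = η := Subtype.ext (hU.comp_comp _)
    have e' : (⟨_, hU.α_αh.mem ⟨_, hU.αh_α.mem ξ⟩⟩ : αh.space) = ξ :=
      Subtype.ext (hU.comp_comp _)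
    rw [e, e']

end IsSymmetry

namespace IsPseudoKacSystem

variable {hm : IsQuadModule αh βh α β} {V : RTP βh α ≃ₗᵢ[ℂ] RTP α β}

/-- With `k = Σ (1 ⊗ U) V` and `x = Uξ'`, one has `V̌ |ξ'⟩₁ = k |x⟩₂`. The bra `⟨ξ|₁ V` becomes `U
⟨ξ|₂ k`, so `k²` acts on `|x⟩₂`; by `k³ = 1` this is `k⁻¹ |x⟩₂ = V* |x⟩₁ U`. -/
theorem bra_V_checkV_ket (h : IsPseudoKacSystem hm V U) (ξ : α.space) (ξ' : αh.space) :
    (ket₁ α β ξ)† ∘L (V : RTP βh α →L[ℂ] RTP α β) ∘L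
        (checkV h.symmetry V : RTP αh βh →L[ℂ] RTP βh α) ∘L ket₁ αh βh ξ' =
      (U : H →L[ℂ] H) ∘L ((ket₁ α β ⟨_, h.symmetry.αh_α.mem ξ'⟩)† ∘L
        (V : RTP βh α →L[ℂ] RTP α β) ∘L ket₂ βh α ξ)† ∘L (U : H →L[ℂ] H) := by
  have hU := h.symmetry
  let x : α.space := ⟨_, hU.αh_α.mem ξ'⟩
  refine ContinuousLinearMap.ext fun v => ext_inner_left ℂ fun w => ?_
  rw [adjoint_regular]
  change ⟪w, ((ket₁ α β ξ)†) (V (checkV hU V (ket₁ αh βh ξ' v)))⟫_ℂ =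
    ⟪w, U (((ket₂ βh α ξ)†) (V.symm (ket₁ α β x (U v))))⟫_ℂ
  have hc := h.cube (ket₂ βh α x v)
  rw [hU.checkV_ket₁]
  set y := kacOp hU V (ket₂ βh α x v) with hy
  -- Cancel the outermost `Σ (1 ⊗ U)` in `k³ |x⟩₂ v = |x⟩₂ v`.
  have h1 : V (kacOp hU V y) = ket₁ α β x (U v) := by
    refine ((mapRight α U hU.β_βh).trans (flip α βh)).injective ?_
    refine Eq.trans hc ?_
    rw [LinearIsometryEquiv.trans_apply, mapRight_ket₁, flip_ket₁, hU.involutive]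
  rw [← h1, LinearIsometryEquiv.symm_apply_apply, ContinuousLinearMap.adjoint_inner_right]
  have h2 : ⟪w, U (((ket₂ βh α ξ)†) (kacOp hU V y))⟫_ℂ =
      ⟪U w, ((ket₂ βh α ξ)†) (kacOp hU V y)⟫_ℂ := by
    rw [← U.inner_map_map (U w), hU.involutive]
  rw [h2, ContinuousLinearMap.adjoint_inner_right]
  have h3 : ket₂ βh α ξ (U w) = flip α βh (mapRight α U hU.β_βh (ket₁ α β ξ w)) := by
    rw [mapRight_ket₁, flip_ket₁]
  rw [h3]
  simp only [kacOp, LinearIsometryEquiv.trans_apply, LinearIsometryEquiv.inner_map_map]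

/-- `[⟨α|₁ V V̌ |αh⟩₁] = [αh αh*]`. -/
theorem cspan_bra_V_checkV_ket (h : IsPseudoKacSystem hm V U) :
    cspan (opMul (opAdj (Set.range (ket₁ α β))) (opMul {(V : RTP βh α →L[ℂ] RTP α β)}
      (opMul {(checkV h.symmetry V : RTP αh βh →L[ℂ] RTP βh α)} (Set.range (ket₁ αh βh))))) =
    cspan (opMul (αh.space : Set (𝔎 →L[ℂ] H)) (opAdj αh.space)) := by
  have hU := h.symmetry
  -- Surjectivity onto the right-hand set uses `U α = α̂`: every index in `α` is `U` of one in `α̂`.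
  have h1 : opMul (opAdj (Set.range (ket₁ α β))) (opMul {(V : RTP βh α →L[ℂ] RTP α β)}
      (opMul {(checkV h.symmetry V : RTP αh βh →L[ℂ] RTP βh α)} (Set.range (ket₁ αh βh)))) =
      opMul {(U : H →L[ℂ] H)} (opMul (opAdj (regularSet V)) {(U : H →L[ℂ] H)}) := by
    ext a
    constructor
    · rintro ⟨_, ⟨_, ⟨ξ, rfl⟩, rfl⟩, _, ⟨_, rfl, _, ⟨_, rfl, _, ⟨ξ', rfl⟩, rfl⟩, rfl⟩, rfl⟩
      exact ⟨_, rfl, _, ⟨_, ⟨_, ⟨_, _, rfl⟩, rfl⟩, _, rfl, rfl⟩, (h.bra_V_checkV_ket ξ ξ').symm⟩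
    · rintro ⟨_, rfl, _, ⟨_, ⟨_, ⟨ξ', ξ, rfl⟩, rfl⟩, _, rfl, rfl⟩, rfl⟩
      refine ⟨_, ⟨_, ⟨ξ, rfl⟩, rfl⟩, _, ⟨_, rfl, _, ⟨_, rfl, _,
        ⟨⟨_, hU.α_αh.mem ξ'⟩, rfl⟩, rfl⟩, rfl⟩, (h.bra_V_checkV_ket ξ _).trans ?_⟩
      have e : (⟨_, hU.αh_α.mem ⟨_, hU.α_αh.mem ξ'⟩⟩ : α.space) = ξ' :=
        Subtype.ext (hU.comp_comp _)
      rw [e]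
  have h2 : opAdj {(U : H →L[ℂ] H)} = {(U : H →L[ℂ] H)} :=
    Set.image_singleton.trans (congrArg _ hU.adjoint_eq)
  have h3 : opMul (opAdj (α.space : Set (𝔎 →L[ℂ] H))) {(U : H →L[ℂ] H)} = opAdj αh.space := by
    rw [← hU.α_αh.opMul_eq, opAdj_opMul, h2]
  rw [h1, cspan_opMul_congr_right _ (cspan_opMul_congr_left h.regular.cspan_opAdj _), opMul_assoc,
    h3, ← opMul_assoc, hU.α_αh.opMul_eq]

end IsPseudoKacSystem

end Kac

end Modules

end PseudoKac

end

/-! ### The product of the two legs -/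

theorem mainTheorem12 {𝔎 H : Type*}
    [NormedAddCommGroup 𝔎] [InnerProductSpace ℂ 𝔎] [CompleteSpace 𝔎]
    [NormedAddCommGroup H] [InnerProductSpace ℂ H] [CompleteSpace H]
    {B Bd : NonUnitalStarSubalgebra ℂ (𝔎 →L[ℂ] 𝔎)}
    (αh : PseudoKac.BaseModule B Bd H) (βh : PseudoKac.BaseModule Bd B H)
    (α : PseudoKac.BaseModule B Bd H) (β : PseudoKac.BaseModule Bd B H)
    (hm : PseudoKac.IsQuadModule αh βh α β)
    (V : PseudoKac.RTP βh α ≃ₗᵢ[ℂ] PseudoKac.RTP α β) (U : H ≃ₗᵢ[ℂ] H)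
    (hVU : PseudoKac.IsPseudoKacSystem hm V U) :
    PseudoKac.cspan {x : H →L[ℂ] H |
        ∃ a ∈ PseudoKac.legA V, ∃ a' ∈ PseudoKac.legAhat V, a ∘L a' = x} =
      PseudoKac.cspan {x : H →L[ℂ] H |
        ∃ ξ ∈ αh.space, ∃ ξ' ∈ αh.space, ξ ∘L ContinuousLinearMap.adjoint ξ' = x} := by
  have hU := hVU.symmetry
  have hA : PseudoKac.legAhat V = PseudoKac.legA (PseudoKac.checkV hU V) := hU.legAhat_eq V
  -- For `V̌` the triple `(β̂, α, β)` is replaced by `(α̂, β̂, α)`, so this reads `[|β̂⟩₁ Â] = [V̌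
  -- |α̂⟩₁ Â]`.
  have h1 := hVU.pmu_check.cspan_ket₁_legA hVU.regular_check
  -- The adjoint of `[Â* α̂] = α̂`, that is, `[α̂* Â] = [α̂*]`.
  have h2 := PseudoKac.cspan_opAdj_congr <| hVU.pmu_check.cspan_adjoint_legA_comp.trans
    (PseudoKac.cspan_coe αh.isClosed).symm
  rw [PseudoKac.opAdj_opMul, PseudoKac.opAdj_opAdj] at h2
  change PseudoKac.cspan (PseudoKac.opMul (PseudoKac.legA V : Set (H →L[ℂ] H))
    (PseudoKac.legAhat V)) = αh.compacts
  -- Expand `A` as `⟨α|₁ V |β̂⟩₁`, absorb `|β̂⟩₁ Â` into `V̌ |α̂⟩₁ Â`, regroup to isolate `⟨α|₁ V V̌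
  -- |α̂⟩₁`, replace it by `α̂ α̂*`, and let `α̂*` absorb `Â`.
  rw [hA, αh.compacts_eq, PseudoKac.legA_eq V, PseudoKac.cspan_opMul_left, PseudoKac.opMul_assoc,
    PseudoKac.opMul_assoc,
    PseudoKac.cspan_opMul_congr_right _ (PseudoKac.cspan_opMul_congr_right _ h1),
    ← PseudoKac.opMul_assoc {_}, ← PseudoKac.opMul_assoc (PseudoKac.opMul _ _),
    ← PseudoKac.opMul_assoc,
    PseudoKac.opMul_assoc {_},
    PseudoKac.cspan_opMul_congr_left hVU.cspan_bra_V_checkV_ket, PseudoKac.opMul_assoc,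
    PseudoKac.cspan_opMul_congr_right _ h2]
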